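/- Let $k$ be a field and let $G$ be a locally profinite group, i.e. a locally compact totally disconnected topological group. A smooth $G$-module over $k$ is a $k$-vector space with a linear action of $G$ in which the stabilizer of every vector is open; smooth $G$-modules form a category $G\text{-}\mathrm{smooth}_k$ (for a compact group $H$ these are the discrete $H$-modules). For a $k$-vector space $V$ and a locally compact totally disconnected space $X$, let $V[[X]]$ be the space of compactly supported finitely additive $V$-valued measures defined on the open-closed subsets of $X$. A $G$-contramodule over $k$ is a $k$-vector space $P$ with a $k$-linear map $\pi\colon P[[G]]\to P$ such that (i) the two compositions $P[[G\times G]]\rightrightarrows P[[G]]\xrightarrow{\pi}P$ coincide, where the first map $P[[G\times G]]\to P[[G]]$ is the pushforward along the multiplication $(g,h)\mapsto gh$, and the second one is the composition of the natural injection $P[[G\times G]]\to P[[G]][[G]]$, $\nu\mapsto(U'\mapsto(U\mapsto\nu(U\times U')))$, with the map $P[[G]][[G]]\to P[[G]]$ induced by $\pi$; and (ii) $\pi$ sends the point measure at the unit element with value $x$ to $x$, for every $x\in P$. Morphisms of $G$-contramodules are the linear maps compatible with $\pi$; the category of $G$-contramodules is denoted by $G\text{-}\mathrm{contra}_k$.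 Smooth $G$-modules and $G$-contramodules restrict to any open subgroup $H\subset G$ (for contramodules, through the pushforward $P[[H]]\to P[[G]]$). A smooth $G$-module is weakly compactly injective if, for some compact open subgroup $H\subset G$, it is an injective object of the category of discrete $H$-modules over $k$. A $G$-contramodule is weakly compactly projective if, for some compact open subgroup $H\subset G$, it is a projective object of the category of $H$-contramodules over $k$. For a smooth $G$-module $N$ and a $G$-contramodule $P$, the contratensor product $N\odot_{k,G}P$ is the quotient of $N\otimes_kP$ by the subspace spanned by all the elements $x\otimes\pi(\mu)-\int_G gx\otimes d\mu_g$ with $x\in N$, $\mu\in P[[G]]$. Let $\mathbf S=k(G)$ be the space of compactly supported locally constant functions $G\to k$ with its two commuting smooth $G$-actions, by left translations $(gf)(x)=f(g^{-1}x)$ and by right translations $(gf)(x)=f(xg)$. Put $\Phi_G(P)=\mathbf S\odot_{k,G}P$, where the contratensor product is formed with respect to the right translations and $G$ acts on the result through the left translations; and put $\Psi_G(M)=\mathrm{Hom}_{k[G]}(\mathbf S,M)$, where the homomorphisms are taken with respect to the left translations and the contraaction is $\pi(\mu)(s)=\int_G d\mu_g(gs)$, with $gs$ the right translation of $s\in\mathbf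 S$. The functor $\Phi_G\colon G\text{-}\mathrm{contra}_k\to G\text{-}\mathrm{smooth}_k$ is left adjoint to $\Psi_G\colon G\text{-}\mathrm{smooth}_k\to G\text{-}\mathrm{contra}_k$, with the adjunction unit $p\mapsto(s\mapsto s\odot p)$ and the adjunction counit $s\odot f\mapsto f(s)$. Proposition. The functors $\Psi_G$ and $\Phi_G$ restrict to mutually inverse equivalences between the full subcategory of weakly compactly injective objects in $G\text{-}\mathrm{smooth}_k$ and the full subcategory of weakly compactly projective objects in $G\text{-}\mathrm{contra}_k$. That is, $\Psi_G$ takes weakly compactly injective smooth modules to weakly compactly projective contramodules, $\Phi_G$ takes weakly compactly projective contramodules to weakly compactly injective smooth modules, and the adjunction counit $\Phi_G\Psi_G(M)\to M$ and unit $P\to\Psi_G\Phi_G(P)$ are isomorphisms for all weakly compactly injective $M$ and all weakly compactly projective $P$. -/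

import Mathlib

open CategoryTheory TopologicalSpace
open scoped TensorProduct

universe w u v

noncomputable section

namespace SemicoSemicontra

/-! ### Compactly supported finitely additive measures -/

section Measures

variable (k : Type*) [Field k] (V : Type*) [AddCommGroup V] [Module k V]
  {W : Type*} [AddCommGroup W] [Module k W] {Z : Type*} [AddCommGroup Z] [Module k Z]
  (X : Type*) [TopologicalSpace X] {Y : Type*} [TopologicalSpace Y]

/-- `V[[X]]`: the `k`-vector space of all compactly supported finitely additive `V`-valued measures
defined on the open-closed subsets of `X`. -/
def Meas : Submodule k (Clopens X → V) where
  carrier := {μ | (∀ U U' : Clopens X, Disjoint U U' → μ (U ⊔ U') = μ U + μ U') ∧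
    ∃ K : Set X, IsCompact K ∧ ∀ U : Clopens X, Disjoint (U : Set X) K → μ U = 0}
  add_mem' := by
    rintro μ ν ⟨hμ, K, hK, hμK⟩ ⟨hν, L, hL, hνL⟩
    refine ⟨fun U U' h => ?_, K ∪ L, hK.union hL, fun U h => ?_⟩
    · simp only [Pi.add_apply, hμ U U' h, hν U U' h]; abel
    · rw [Set.disjoint_union_right] at h
      simp [hμK U h.1, hνL U h.2]
  zero_mem' := ⟨by simp, ∅, isCompact_empty, by simp⟩
  smul_mem' := by
    rintro c μ ⟨hμ, K, hK, hμK⟩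
    refine ⟨fun U U' h => ?_, K, hK, fun U h => ?_⟩
    · simp [hμ U U' h]
    · simp [hμK U h]

variable {k V X}

namespace Meas

theorem additive (μ : Meas k V X) (U U' : Clopens X) (h : Disjoint U U') :
    μ.1 (U ⊔ U') = μ.1 U + μ.1 U' := μ.2.1 U U' h

theorem exists_support (μ : Meas k V X) :
    ∃ K : Set X, IsCompact K ∧ ∀ U : Clopens X, Disjoint (U : Set X) K → μ.1 U = 0 := μ.2.2

/-- The inverse image of an open-closed subset. -/
def preimage (f : C(X, Y)) (U : Clopens Y) : Clopens X :=
  ⟨f ⁻¹' U, U.isClopen.preimage f.continuous⟩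

/-- The pushforward of measures `V[[X]] → V[[Y]]` along a continuous map. -/
def map (f : C(X, Y)) : Meas k V X →ₗ[k] Meas k V Y where
  toFun μ := ⟨fun U => μ.1 (preimage f U), by
    obtain ⟨K, hK, hμK⟩ := exists_support μ
    refine ⟨fun U U' h => ?_, f '' K, hK.image f.continuous, fun U h => hμK _ ?_⟩
    · refine additive μ (preimage f U) (preimage f U') ?_
      rw [← Clopens.coe_disjoint] at h ⊢
      exact h.preimage f
    · rw [Set.disjoint_left] at h ⊢
      exact fun a ha haK => h ha ⟨a, haK, rfl⟩⟩
  map_add' _ _ := rfl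
  map_smul' _ _ := rfl

/-- The map `V[[X]] → W[[X]]` induced by a linear map `V → W`. -/
def mapValue (φ : V →ₗ[k] W) : Meas k V X →ₗ[k] Meas k W X where
  toFun μ := ⟨fun U => φ (μ.1 U), by
    obtain ⟨K, hK, hμK⟩ := exists_support μ
    exact ⟨fun U U' h => (congrArg φ (additive μ U U' h)).trans (map_add φ _ _), K, hK,
      fun U h => (congrArg φ (hμK U h)).trans (map_zero φ)⟩⟩
  map_add' μ ν := Subtype.ext (funext fun U => map_add φ (μ.1 U) (ν.1 U))
  map_smul' c μ := Subtype.ext (funext fun U => map_smul φ c (μ.1 U))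

/-- The natural injection `V[[X × Y]] → V[[X]][[Y]]`; it sends `ν` to the measure whose value at
`U' ⊆ Y` is the measure `U ↦ ν (U × U')` on `X`. -/
def curry : Meas k V (X × Y) →ₗ[k] Meas k (Meas k V X) Y where
  toFun ν := ⟨fun U' => ⟨fun U => ν.1 (U ×ˢ U'), by
      obtain ⟨K, hK, hν⟩ := exists_support ν
      refine ⟨fun U₁ U₂ h => ?_, Prod.fst '' K, hK.image continuous_fst, fun U h => hν _ ?_⟩
      · refine (congrArg ν.1 (Clopens.ext Set.union_prod)).trans (additive ν _ _ ?_)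
        rw [← Clopens.coe_disjoint] at h ⊢
        exact Set.disjoint_prod.2 (Or.inl h)
      · rw [Set.disjoint_left] at h ⊢
        exact fun a ha haK => h ha.1 ⟨a, haK, rfl⟩⟩, by
    obtain ⟨K, hK, hν⟩ := exists_support ν
    refine ⟨fun U₁ U₂ h => Subtype.ext (funext fun U => ?_), Prod.snd '' K,
      hK.image continuous_snd, fun U' h => Subtype.ext (funext fun U => hν _ ?_)⟩
    · refine (congrArg ν.1 (Clopens.ext Set.prod_union)).trans (additive ν _ _ ?_)
      rw [← Clopens.coe_disjoint] at h ⊢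
      exact Set.disjoint_prod.2 (Or.inr h)
    · rw [Set.disjoint_left] at h ⊢
      exact fun a ha haK => h ha.2 ⟨a, haK, rfl⟩⟩
  map_add' _ _ := rfl
  map_smul' _ _ := rfl

open Classical in
/-- The point measure concentrated at `x`, with a given value in `V`. -/
def dirac (x : X) : V →ₗ[k] Meas k V X where
  toFun a := ⟨fun U => if x ∈ U then a else 0, by
    refine ⟨fun U U' h => ?_, {x}, isCompact_singleton, fun U h => ?_⟩
    · have hx : x ∈ U → x ∉ U' := fun h₁ h₂ =>
        Set.disjoint_left.1 (Clopens.coe_disjoint.2 h) h₁ h₂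
      have hs : x ∈ U ⊔ U' ↔ x ∈ U ∨ x ∈ U' := Iff.rfl
      by_cases h₁ : x ∈ U
      · simp [hs, h₁, hx h₁]
      · simp [hs, h₁]
    · exact if_neg (Set.disjoint_singleton_right.1 h)⟩
  map_add' a b := Subtype.ext (funext fun U => by
    by_cases h : x ∈ U <;> simp [h])
  map_smul' c a := Subtype.ext (funext fun U => by
    by_cases h : x ∈ U <;> simp [h])

/-- The fibre of a locally constant map, as an open-closed subset. -/
def fibre {A : Type*} (f : LocallyConstant X A) (a : A) : Clopens X :=
  ⟨f ⁻¹' {a}, f.isLocallyConstant.isClopen_fiber a⟩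

/-- The integral `∫ F dμ` of a locally constant function `F : X → Hom_k(V, Z)` with respect to
a compactly supported `V`-valued measure `μ`. Only finitely many summands are nonzero, since `F`
takes finitely many values on a compact support of `μ`. -/
def integral (F : LocallyConstant X (V →ₗ[k] Z)) (μ : Meas k V X) : Z :=
  ∑ᶠ φ : V →ₗ[k] Z, φ (μ.1 (fibre F φ))

theorem apply_bot (μ : Meas k V X) : μ.1 ⊥ = 0 := by
  obtain ⟨K, -, h⟩ := exists_support μ
  exact h ⊥ (by simp)

theorem apply_finset_sup {ι : Type*} (μ : Meas k V X) (s : Finset ι) (U : ι → Clopens X)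
    (h : ∀ i ∈ s, ∀ j ∈ s, i ≠ j → Disjoint (U i) (U j)) :
    μ.1 (s.sup U) = ∑ i ∈ s, μ.1 (U i) := by
  classical
  induction s using Finset.induction with
  | empty => simpa using apply_bot μ
  | insert a s ha ih =>
    rw [Finset.sup_insert, additive μ, Finset.sum_insert ha, ih]
    · exact fun i hi j hj => h i (Finset.mem_insert_of_mem hi) j (Finset.mem_insert_of_mem hj)
    · rw [Finset.disjoint_sup_right]
      intro j hj
      exact h a (Finset.mem_insert_self _ _) j (Finset.mem_insert_of_mem hj)
        (fun e => ha (e ▸ hj))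

/-- A finite set of values of `f` that carries the measure. -/
theorem exists_finset {A : Type*} (f : LocallyConstant X A) (μ : Meas k V X) :
    ∃ s : Finset A, ∀ U : Clopens X, (∀ x ∈ U, f x ∉ s) → μ.1 U = 0 := by
  obtain ⟨K, hK, h⟩ := exists_support μ
  have hfin : (f '' K).Finite := by
    let _ : TopologicalSpace A := ⊥
    have : DiscreteTopology A := ⟨rfl⟩
    exact (hK.image f.isLocallyConstant.continuous).finite_of_discrete
  refine ⟨hfin.toFinset, fun U hU => h U ?_⟩
  rw [Set.disjoint_left]
  intro x hx hxK
  exact hU x hx (hfin.mem_toFinset.2 ⟨x, hxK, rfl⟩)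

open Classical in
theorem apply_eq_sum {A : Type*} (f : LocallyConstant X A) (μ : Meas k V X) (s : Finset A)
    (hs : ∀ U : Clopens X, (∀ x ∈ U, f x ∉ s) → μ.1 U = 0) (T : Set A) (U : Clopens X)
    (hU : (U : Set X) = f ⁻¹' T) :
    μ.1 U = ∑ a ∈ s with a ∈ T, μ.1 (fibre f a) := by
  have hmem : ∀ x, x ∈ (s.filter (· ∈ T)).sup (fibre f) ↔ f x ∈ s ∧ f x ∈ T := by
    intro x
    rw [← SetLike.mem_coe, Clopens.coe_finset_sup]
    constructor
    · rintro h
      obtain ⟨a, ha, hx⟩ := Set.mem_iUnion₂.1 h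
      obtain rfl : f x = a := hx
      exact Finset.mem_filter.1 ha
    · exact fun h => Set.mem_iUnion₂.2 ⟨f x, Finset.mem_filter.2 h, rfl⟩
  rw [← apply_finset_sup]
  · have hle : U = (s.filter (· ∈ T)).sup (fibre f) ⊔ U \ (s.filter (· ∈ T)).sup (fibre f) := by
      rw [sup_sdiff_self_right, eq_comm, sup_eq_right]
      intro x hx
      have := (hmem x).1 hx
      change x ∈ (U : Set X)
      rw [hU]
      exact this.2
    conv_lhs => rw [hle]
    rw [additive μ _ _ disjoint_sdiff_self_right, hs (U \ _), add_zero]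
    rintro x ⟨hx, hx'⟩ hxs
    rw [hU] at hx
    exact hx' ((hmem x).2 ⟨hxs, hx⟩)
  · intro a _ b _ hab
    rw [← Clopens.coe_disjoint, Set.disjoint_left]
    rintro x rfl hx
    exact hab hx

/-- The integral can be computed on any partition into fibres on which the integrand is constant. -/
theorem integral_eq_finsum {A : Type*} (f : LocallyConstant X A) (Φ : A → V →ₗ[k] Z)
    (F : LocallyConstant X (V →ₗ[k] Z)) (hF : ∀ x, F x = Φ (f x)) (μ : Meas k V X) :
    integral F μ = ∑ᶠ a, Φ a (μ.1 (fibre f a)) := by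
  classical
  obtain ⟨s, hs⟩ := exists_finset f μ
  have hzero : ∀ a, a ∉ s → μ.1 (fibre f a) = 0 := by
    rintro a ha
    refine hs _ ?_
    rintro x rfl
    exact ha
  rw [finsum_eq_sum_of_support_subset (s := s), integral,
    finsum_eq_sum_of_support_subset (s := s.image Φ)]
  · rw [← Finset.sum_fiberwise_of_maps_to (g := Φ) (t := s.image Φ)
      (fun a ha => Finset.mem_image_of_mem _ ha)]
    refine Finset.sum_congr rfl fun φ _ => ?_
    rw [apply_eq_sum f μ s hs {a | Φ a = φ} (fibre F φ), map_sum]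
    · refine Finset.sum_congr rfl fun a ha => ?_
      rw [Finset.mem_filter] at ha
      rw [show Φ a = φ from ha.2]
    · ext x
      change F x = φ ↔ Φ (f x) = φ
      rw [hF]
  · intro φ hφ
    by_contra hn
    refine hφ ?_
    change φ (μ.1 (fibre F φ)) = 0
    rw [hs, map_zero]
    rintro x rfl hx
    refine hn ?_
    rw [hF]
    exact Finset.mem_coe.2 (Finset.mem_image_of_mem _ hx)
  · intro a ha
    by_contra hn
    refine ha ?_
    change Φ a (μ.1 (fibre f a)) = 0
    rw [hzero a hn, map_zero]

theorem hasFiniteSupport_fibre {A : Type*} (f : LocallyConstant X A) (Φ : A → V →ₗ[k] Z)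
    (μ : Meas k V X) : (Function.support fun a => Φ a (μ.1 (fibre f a))).Finite := by
  obtain ⟨s, hs⟩ := exists_finset f μ
  refine s.finite_toSet.subset fun a ha => ?_
  by_contra hn
  refine ha ?_
  change Φ a (μ.1 (fibre f a)) = 0
  rw [hs, map_zero]
  rintro x rfl
  exact hn

theorem integral_add_left (F F' F'' : LocallyConstant X (V →ₗ[k] Z)) (h : ∀ x, F'' x = F x + F' x)
    (μ : Meas k V X) : integral F'' μ = integral F μ + integral F' μ := by
  let f : LocallyConstant X ((V →ₗ[k] Z) × (V →ₗ[k] Z)) :=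
    ⟨fun x => (F x, F' x), F.isLocallyConstant.prodMk F'.isLocallyConstant⟩
  rw [integral_eq_finsum f (fun a => a.1 + a.2) F'' h,
    integral_eq_finsum f (fun a => a.1) F (fun _ => rfl),
    integral_eq_finsum f (fun a => a.2) F' (fun _ => rfl)]
  exact finsum_add_distrib (hasFiniteSupport_fibre f (fun a => a.1) μ)
    (hasFiniteSupport_fibre f (fun a => a.2) μ)

theorem map_integral {Z' : Type*} [AddCommGroup Z'] [Module k Z'] (l : Z →ₗ[k] Z')
    (F : LocallyConstant X (V →ₗ[k] Z)) (F' : LocallyConstant X (V →ₗ[k] Z'))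
    (h : ∀ x, F' x = l ∘ₗ F x) (μ : Meas k V X) :
    l (integral F μ) = integral F' μ := by
  rw [integral_eq_finsum F (fun φ => l ∘ₗ φ) F' h]
  exact map_finsum l (hasFiniteSupport_fibre F id μ)

theorem integral_mapValue (φ : V →ₗ[k] W) (F : LocallyConstant X (W →ₗ[k] Z))
    (F' : LocallyConstant X (V →ₗ[k] Z)) (h : ∀ x, F' x = F x ∘ₗ φ) (μ : Meas k V X) :
    integral F (mapValue φ μ) = integral F' μ :=
  (integral_eq_finsum F (fun ψ => ψ ∘ₗ φ) F' h μ).symm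

theorem integral_map (f : C(X, Y)) (F : LocallyConstant Y (V →ₗ[k] Z))
    (F' : LocallyConstant X (V →ₗ[k] Z)) (h : ∀ x, F' x = F (f x)) (μ : Meas k V X) :
    integral F (map f μ) = integral F' μ := by
  refine finsum_congr fun φ => congrArg φ (congrArg μ.1 (Clopens.ext ?_))
  ext x
  change F (f x) = φ ↔ F' x = φ
  rw [h]

theorem integral_dirac (x : X) (a : V) (F : LocallyConstant X (V →ₗ[k] Z)) :
    integral F (dirac x a) = F x a := by
  rw [integral, finsum_eq_single _ (F x)]
  · exact congrArg (F x) (if_pos rfl)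
  · intro φ hφ
    have : (dirac (k := k) x a).1 (fibre F φ) = 0 := if_neg fun h => hφ h.symm
    rw [this, map_zero]

/-- Integration as a linear function of the measure. -/
def integralₗ (F : LocallyConstant X (V →ₗ[k] Z)) : Meas k V X →ₗ[k] Z where
  toFun μ := integral F μ
  map_add' μ ν := by
    refine Eq.trans (finsum_congr fun φ => map_add φ _ _)
      (finsum_add_distrib (hasFiniteSupport_fibre F id μ) (hasFiniteSupport_fibre F id ν))
  map_smul' c μ := by
    rw [integral, integral, RingHom.id_apply]
    refine Eq.trans (finsum_congr fun φ => map_smul φ c _)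
      (map_finsum (DistribSMul.toAddMonoidHom Z c) (hasFiniteSupport_fibre F id μ)).symm

/-- Iterated integration. -/
theorem integral_curry (F₁ : LocallyConstant Y (LocallyConstant X (V →ₗ[k] Z)))
    (F : LocallyConstant (X × Y) (V →ₗ[k] Z)) (h : ∀ x y, F (x, y) = F₁ y x)
    (ν : Meas k V (X × Y)) :
    integral (F₁.map integralₗ) (curry ν) = integral F ν := by
  let f : LocallyConstant (X × Y) (LocallyConstant X (V →ₗ[k] Z) × (V →ₗ[k] Z)) :=
    ⟨fun p => (F₁ p.2, F p),
      (F₁.isLocallyConstant.comp_continuous continuous_snd).prodMk F.isLocallyConstant⟩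
  rw [integral_eq_finsum F₁ integralₗ (F₁.map integralₗ) (fun _ => rfl),
    integral_eq_finsum f (fun a => a.2) F (fun _ => rfl),
    finsum_curry _ (hasFiniteSupport_fibre f (fun a => a.2) ν)]
  refine finsum_congr fun Θ => finsum_congr fun φ => congrArg φ (congrArg ν.1 (Clopens.ext ?_))
  ext ⟨x, y⟩
  change (Θ x = φ ∧ F₁ y = Θ) ↔ (F₁ y, F (x, y)) = (Θ, φ)
  rw [h, Prod.mk.injEq]
  constructor
  · rintro ⟨rfl, rfl⟩
    exact ⟨rfl, rfl⟩
  · rintro ⟨rfl, rfl⟩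
    exact ⟨rfl, rfl⟩

end Meas
end Measures

/-! ### Smooth modules -/

section Smooth

variable (k : Type u) [Field k] (G : Type v) [Group G] [TopologicalSpace G]

/-- A `G`-module over `k` is smooth if the stabilizer of every element is open in `G`. -/
def IsSmooth {k : Type*} [Field k] {G : Type*} [Group G] [TopologicalSpace G] {N : Type*}
    [AddCommGroup N] [Module k N] (ρ : Representation k G N) : Prop :=
  ∀ x : N, IsOpen {g : G | ρ g x = x}

/-- The property of being a smooth `G`-module over `k`. -/
def isSmooth : ObjectProperty (Rep.{w} k G) := fun M => IsSmooth M.ρ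

/-- The category of smooth `G`-modules over `k`, a full subcategory of the category of
`G`-modules over `k`. For a profinite group these are the discrete modules. -/
abbrev SmoothModule := (isSmooth.{w} k G).FullSubcategory

variable {k G}

/-- Restriction of smooth modules to a subgroup. -/
def SmoothModule.res (H : Subgroup G) : SmoothModule.{w} k G ⥤ SmoothModule.{w} k H where
  obj M := ⟨Rep.of (M.obj.ρ.comp H.subtype), fun x => (M.property x).preimage continuous_subtype_val⟩
  map f := ObjectProperty.homMk (Rep.ofHom
    { f.hom.hom.toLinearMap with
      isIntertwining' := fun g => f.hom.hom.isIntertwining' g })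
  map_id _ := rfl
  map_comp _ _ := rfl

variable (k G)

/-- A smooth `G`-module is weakly compactly injective if there is a compact open subgroup `H` of
`G` such that it is injective as an object of the category of discrete `H`-modules over `k`. -/
def WeaklyCompactlyInjective : ObjectProperty (SmoothModule.{w} k G) := fun M =>
  ∃ H : Subgroup G, IsOpen (H : Set G) ∧ IsCompact (H : Set G) ∧
    Injective ((SmoothModule.res H).obj M)

end Smooth

/-! ### Contramodules -/

section Contra

variable (k : Type u) [Field k] (G : Type v) [Group G] [TopologicalSpace G] [IsTopologicalGroup G]

/-- The multiplication `G × G → G` as a continuous map. -/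
def mulMap : C(G × G, G) := ⟨fun p => p.1 * p.2, continuous_mul⟩

/-- A `G`-contramodule over `k`: a `k`-vector space with a contraassociative and contraunital
contraaction map `π : V[[G]] → V`. -/
structure Contramodule where
  /-- the underlying vector space -/
  V : Type w
  [addCommGroup : AddCommGroup V]
  [module : Module k V]
  /-- the contraaction map -/
  π : Meas k V G →ₗ[k] V
  contraassoc : ∀ ν : Meas k V (G × G),
    π (Meas.mapValue π (Meas.curry ν)) = π (Meas.map (mulMap G) ν)
  contraunit : ∀ x : V, π (Meas.dirac 1 x) = x

attribute [instance] Contramodule.addCommGroup Contramodule.module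

namespace Contramodule

variable {k G}

/-- Morphisms of contramodules: linear maps compatible with the contraactions. -/
@[ext]
structure Hom (P Q : Contramodule.{w} k G) where
  /-- the underlying linear map -/
  lin : P.V →ₗ[k] Q.V
  comm : ∀ μ : Meas k P.V G, lin (P.π μ) = Q.π (Meas.mapValue lin μ)

/-- The category of `G`-contramodules over `k`. -/
instance : Category (Contramodule.{w} k G) where
  Hom P Q := Hom P Q
  id P := ⟨LinearMap.id, fun _ => rfl⟩
  comp f g := ⟨g.lin ∘ₗ f.lin, fun μ => (congrArg g.lin (f.comm μ)).trans (g.comm _)⟩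

/-- Restriction of contramodules to a subgroup `H`: the contraaction is the composition
`V[[H]] → V[[G]] → V` of the pushforward along the inclusion and the contraaction of `G`. -/
def res (H : Subgroup G) : Contramodule.{w} k G ⥤ Contramodule.{w} k H where
  obj P :=
    { V := P.V
      π := P.π ∘ₗ Meas.map ⟨H.subtype, continuous_subtype_val⟩
      contraassoc := fun ν =>
        P.contraassoc (Meas.map ⟨Prod.map H.subtype H.subtype,
          continuous_subtype_val.prodMap continuous_subtype_val⟩ ν)
      contraunit := fun x => by
        refine Eq.trans (congrArg P.π ?_) (P.contraunit x)
        rfl }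
  map f := ⟨f.lin, fun μ => f.comm _⟩
  map_id _ := rfl
  map_comp _ _ := rfl

end Contramodule

/-- A `G`-contramodule is weakly compactly projective if there is a compact open subgroup `H` of
`G` such that it is projective as an object of the category of `H`-contramodules over `k`. -/
def WeaklyCompactlyProjective : ObjectProperty (Contramodule.{w} k G) := fun P =>
  ∃ H : Subgroup G, IsOpen (H : Set G) ∧ IsCompact (H : Set G) ∧
    Projective ((Contramodule.res H).obj P)

end Contra

/-! ### Contratensor product -/

section Contratensor

variable {k : Type u} [Field k] {G : Type v} [Group G] [TopologicalSpace G] [IsTopologicalGroup G]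

/-- For a smooth `G`-module, `g ↦ g x` is a locally constant function on `G`. -/
def orbit {N : Type*} [AddCommGroup N] [Module k N] (ρ : Representation k G N) (hρ : IsSmooth ρ)
    (x : N) : LocallyConstant G N where
  toFun g := ρ g x
  isLocallyConstant := by
    refine (IsLocallyConstant.iff_exists_open _).2 fun g =>
      ⟨(fun g' => g⁻¹ * g') ⁻¹' {h | ρ h x = x}, (hρ x).preimage (continuous_const_mul g⁻¹),
        by simp, fun g' hg' => ?_⟩
    have h : ρ (g⁻¹ * g') x = x := hg'
    conv_rhs => rw [← h]
    rw [← Module.End.mul_apply, ← map_mul, mul_inv_cancel_left]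

/-- The subspace of `N ⊗ P` spanned by the differences `x ⊗ π(μ) - ∫ (g x) ⊗ dμ_g`. -/
def contratensorRel {N : Type*} [AddCommGroup N] [Module k N] (ρ : Representation k G N)
    (hρ : IsSmooth ρ) (P : Contramodule.{w} k G) : Submodule k (N ⊗[k] P.V) :=
  Submodule.span k (Set.range fun a : N × Meas k P.V G =>
    a.1 ⊗ₜ[k] P.π a.2 - Meas.integral ((orbit ρ hρ a.1).map (TensorProduct.mk k N P.V)) a.2)

/-- The contratensor product `N ⊙_{k,G} P` of a smooth `G`-module and a `G`-contramodule. -/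
def Contratensor {N : Type*} [AddCommGroup N] [Module k N] (ρ : Representation k G N)
    (hρ : IsSmooth ρ) (P : Contramodule.{w} k G) := (N ⊗[k] P.V) ⧸ contratensorRel ρ hρ P

namespace Contratensor

variable {N : Type*} [AddCommGroup N] [Module k N] (ρ : Representation k G N) (hρ : IsSmooth ρ)
  (P Q : Contramodule.{w} k G) {Z : Type*} [AddCommGroup Z] [Module k Z]

instance : AddCommGroup (Contratensor ρ hρ P) :=
  inferInstanceAs (AddCommGroup ((N ⊗[k] P.V) ⧸ contratensorRel ρ hρ P))

instance : Module k (Contratensor ρ hρ P) :=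
  inferInstanceAs (Module k ((N ⊗[k] P.V) ⧸ contratensorRel ρ hρ P))

/-- The quotient map `N ⊗ P → N ⊙_{k,G} P`. -/
def mk : N ⊗[k] P.V →ₗ[k] Contratensor ρ hρ P := (contratensorRel ρ hρ P).mkQ

theorem mk_surjective : Function.Surjective (mk ρ hρ P) := Submodule.mkQ_surjective _

theorem mk_pi (x : N) (μ : Meas k P.V G) : mk ρ hρ P (x ⊗ₜ[k] P.π μ) =
    mk ρ hρ P (Meas.integral ((orbit ρ hρ x).map (TensorProduct.mk k N P.V)) μ) :=
  (Submodule.Quotient.eq _).2 (Submodule.subset_span ⟨(x, μ), rfl⟩)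

theorem mk_pi' (x : N) (μ : Meas k P.V G) (F : LocallyConstant G (P.V →ₗ[k] Contratensor ρ hρ P))
    (hF : ∀ g p, F g p = mk ρ hρ P (ρ g x ⊗ₜ[k] p)) :
    mk ρ hρ P (x ⊗ₜ[k] P.π μ) = Meas.integral F μ :=
  (mk_pi ρ hρ P x μ).trans (Meas.map_integral _ _ F (fun g => LinearMap.ext (hF g)) μ)

variable {ρ hρ P Q}

theorem lin_ext {l l' : Contratensor ρ hρ P →ₗ[k] Z}
    (h : ∀ x p, l (mk ρ hρ P (x ⊗ₜ[k] p)) = l' (mk ρ hρ P (x ⊗ₜ[k] p))) : l = l' :=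
  Submodule.linearMap_qext _ (TensorProduct.ext' h)

/-- A linear map out of `N ⊗ P` that respects the relations factors through `N ⊙_{k,G} P`. -/
def lift (l : N ⊗[k] P.V →ₗ[k] Z)
    (h : ∀ x μ, l (x ⊗ₜ[k] P.π μ) =
      Meas.integral ((orbit ρ hρ x).map fun y => l ∘ₗ TensorProduct.mk k N P.V y) μ) :
    Contratensor ρ hρ P →ₗ[k] Z :=
  (contratensorRel ρ hρ P).liftQ l (by
    refine Submodule.span_le.2 ?_
    rintro _ ⟨⟨x, μ⟩, rfl⟩
    refine LinearMap.mem_ker.2 ((map_sub l _ _).trans (sub_eq_zero.2 ((h x μ).trans ?_)))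
    exact (Meas.map_integral l _ _ (fun _ => rfl) μ).symm)

theorem lift_mk (l : N ⊗[k] P.V →ₗ[k] Z) (h) (t : N ⊗[k] P.V) :
    lift (ρ := ρ) (hρ := hρ) l h (mk ρ hρ P t) = l t := rfl

/-- The contratensor product is functorial. -/
def map {N' : Type*} [AddCommGroup N'] [Module k N'] {ρ' : Representation k G N'}
    {hρ' : IsSmooth ρ'} (f : ρ.IntertwiningMap ρ') (φ : P ⟶ Q) :
    Contratensor ρ hρ P →ₗ[k] Contratensor ρ' hρ' Q :=
  lift (mk ρ' hρ' Q ∘ₗ TensorProduct.map f.toLinearMap φ.lin) (fun x μ => by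
    have h : mk ρ' hρ' Q (f x ⊗ₜ[k] φ.lin (P.π μ)) = mk ρ' hρ' Q (Meas.integral
        ((orbit ρ' hρ' (f x)).map (TensorProduct.mk k N' Q.V)) (Meas.mapValue φ.lin μ)) := by
      rw [φ.comm, mk_pi]
    refine h.trans ?_
    rw [Meas.map_integral (mk ρ' hρ' Q) _
      ((orbit ρ' hρ' (f x)).map fun y => mk ρ' hρ' Q ∘ₗ TensorProduct.mk k N' Q.V y) (fun _ => rfl)]
    refine Meas.integral_mapValue φ.lin _ _ (fun g => LinearMap.ext fun p => ?_) μ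
    change mk ρ' hρ' Q (f (ρ g x) ⊗ₜ[k] φ.lin p) = mk ρ' hρ' Q (ρ' g (f x) ⊗ₜ[k] φ.lin p)
    rw [f.isIntertwining])

theorem map_mk {N' : Type*} [AddCommGroup N'] [Module k N'] {ρ' : Representation k G N'}
    {hρ' : IsSmooth ρ'} (f : ρ.IntertwiningMap ρ') (φ : P ⟶ Q) (x : N) (p : P.V) :
    map (hρ := hρ) (hρ' := hρ') f φ (mk ρ hρ P (x ⊗ₜ[k] p)) =
      mk ρ' hρ' Q (f x ⊗ₜ[k] φ.lin p) := rfl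

end Contratensor

end Contratensor

/-! ### The smooth `(G × G)`-module of compactly supported locally constant functions -/

section Regular

variable (k : Type u) [Field k] (G : Type v) [Group G] [TopologicalSpace G] [IsTopologicalGroup G]

/-- `k(G)`: the vector space of compactly supported locally constant functions `G → k`. -/
def Reg : Submodule k (G → k) where
  carrier := {f | IsLocallyConstant f ∧ HasCompactSupport f}
  add_mem' hf hg := ⟨hf.1.add hg.1, hf.2.add hg.2⟩
  zero_mem' := ⟨IsLocallyConstant.const 0, HasCompactSupport.zero⟩
  smul_mem' c _ hf := ⟨hf.1.comp (c * ·), hf.2.smul_left (f := fun _ => c)⟩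

/-- The action of `G` on `k(G)` by left translations, `(g f)(x) = f (g⁻¹ x)`. -/
def regLeft : Representation k G (Reg k G) where
  toFun g :=
    { toFun := fun f => ⟨fun x => f.1 (g⁻¹ * x),
        f.2.1.comp_continuous (continuous_const_mul g⁻¹),
        f.2.2.comp_homeomorph (Homeomorph.mulLeft g⁻¹)⟩
      map_add' := fun _ _ => rfl
      map_smul' := fun _ _ => rfl }
  map_one' := by ext f x; simp
  map_mul' g h := by ext f x; simp [mul_assoc]

/-- The action of `G` on `k(G)` by right translations, `(g f)(x) = f (x g)`. -/
def regRight : Representation k G (Reg k G) where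
  toFun g :=
    { toFun := fun f => ⟨fun x => f.1 (x * g),
        f.2.1.comp_continuous (continuous_mul_const g),
        f.2.2.comp_homeomorph (Homeomorph.mulRight g)⟩
      map_add' := fun _ _ => rfl
      map_smul' := fun _ _ => rfl }
  map_one' := by ext f x; simp
  map_mul' g h := by ext f x; simp [mul_assoc]

variable {k G}

theorem regLeft_regRight (g h : G) (f : Reg k G) :
    regLeft k G g (regRight k G h f) = regRight k G h (regLeft k G g f) :=
  Subtype.ext (funext fun x => congrArg f.1 (mul_assoc g⁻¹ x h))

theorem isSmooth_of_eventually {N : Type*} [AddCommGroup N] [Module k N]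
    (ρ : Representation k G N) (h : ∀ x, ∀ᶠ g in nhds (1 : G), ρ g x = x) : IsSmooth ρ := by
  intro x
  let S : Subgroup G :=
    { carrier := {g | ρ g x = x}
      mul_mem' := fun {a b} ha hb => by
        change ρ (a * b) x = x
        rw [map_mul, Module.End.mul_apply, show ρ b x = x from hb, show ρ a x = x from ha]
      one_mem' := by simp
      inv_mem' := fun {a} ha => by
        change ρ a⁻¹ x = x
        conv_lhs => rw [← show ρ a x = x from ha]
        rw [← Module.End.mul_apply, ← map_mul, inv_mul_cancel, map_one, Module.End.one_apply] }
  exact S.isOpen_of_mem_nhds (h x)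

theorem Reg.eventually_eq (f : Reg k G) (a : G → G → G) (ha : Continuous fun p : G × G => a p.1 p.2)
    (ha₁ : ∀ x, a 1 x = x) (ha₂ : ∀ g x, a g⁻¹ (a g x) = x) :
    ∀ᶠ g in nhds (1 : G), ∀ x, f.1 (a g x) = f.1 x := by
  have h₁ : ∀ᶠ g in nhds (1 : G), ∀ x ∈ tsupport f.1, f.1 (a g x) = f.1 x := by
    refine IsCompact.eventually_forall_of_forall_eventually f.2.2 fun x _ => ?_
    have hc : IsOpen {p : G × G | f.1 (a p.1 p.2) = f.1 x} :=
      (f.2.1.isOpen_fiber (f.1 x)).preimage ha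
    have hd : IsOpen {p : G × G | f.1 p.2 = f.1 x} :=
      (f.2.1.isOpen_fiber (f.1 x)).preimage continuous_snd
    filter_upwards [hc.mem_nhds (show f.1 (a 1 x) = f.1 x by rw [ha₁]),
      hd.mem_nhds (show f.1 x = f.1 x from rfl)] with p hp hq
    exact Eq.trans hp (Eq.symm hq)
  have h₂ : ∀ᶠ g in nhds (1 : G), ∀ x ∈ tsupport f.1, f.1 (a g⁻¹ x) = f.1 x := by
    have : Filter.Tendsto (fun g : G => g⁻¹) (nhds 1) (nhds 1) := by
      simpa using (continuous_inv (G := G)).tendsto 1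
    exact this.eventually h₁
  filter_upwards [h₁, h₂] with g hg hg' x
  by_cases hx : x ∈ tsupport f.1
  · exact hg x hx
  · rw [image_eq_zero_of_notMem_tsupport hx]
    by_contra hne
    have h := hg' (a g x) (subset_tsupport _ hne)
    rw [ha₂, image_eq_zero_of_notMem_tsupport hx] at h
    exact hne h.symm

theorem isSmooth_regRight : IsSmooth (regRight k G) := by
  refine isSmooth_of_eventually _ fun f => ?_
  filter_upwards [Reg.eventually_eq f (fun g x => x * g) (continuous_snd.mul continuous_fst)
    mul_one (fun g x => mul_inv_cancel_right x g)] with g hg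
  exact Subtype.ext (funext hg)

theorem isSmooth_regLeft : IsSmooth (regLeft k G) := by
  refine isSmooth_of_eventually _ fun f => ?_
  filter_upwards [Reg.eventually_eq f (fun g x => g⁻¹ * x)
    (continuous_fst.inv.mul continuous_snd) (fun x => by simp) (fun g x => by simp)] with g hg
  exact Subtype.ext (funext hg)

end Regular

/-! ### The functors -/

section Functors

variable (k : Type u) [Field k] (G : Type v) [Group G] [TopologicalSpace G] [IsTopologicalGroup G]

/-- Left translation as an endomorphism of `k(G)` with the action by right translations. -/
def leftTranslation (g : G) : (regRight k G).IntertwiningMap (regRight k G) :=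
  ⟨regLeft k G g, fun h => LinearMap.ext fun f => regLeft_regRight g h f⟩

/-- The representation of `G` on `k(G) ⊙_{k,G} P`, coming from the action of `G` on `k(G)` by left
translations. The contratensor product is taken with respect to the right translations. -/
def phiRep (P : Contramodule.{w} k G) :
    Representation k G (Contratensor (regRight k G) isSmooth_regRight P) where
  toFun g := Contratensor.map (leftTranslation k G g) (𝟙 P)
  map_one' := Contratensor.lin_ext fun s p => by
    change Contratensor.mk _ _ P (regLeft k G 1 s ⊗ₜ[k] p) = _
    rw [map_one, Module.End.one_apply, Module.End.one_apply]
  map_mul' g h := Contratensor.lin_ext fun s p => by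
    change Contratensor.mk _ _ P (regLeft k G (g * h) s ⊗ₜ[k] p) =
      Contratensor.mk _ _ P (regLeft k G g (regLeft k G h s) ⊗ₜ[k] p)
    rw [map_mul, Module.End.mul_apply]

theorem phiRep_mk (P : Contramodule.{w} k G) (g : G) (s : Reg k G) (p : P.V) :
    phiRep k G P g (Contratensor.mk _ _ P (s ⊗ₜ[k] p)) =
      Contratensor.mk _ _ P (regLeft k G g s ⊗ₜ[k] p) := rfl

theorem isSmooth_phiRep (P : Contramodule.{w} k G) : IsSmooth (phiRep k G P) := by
  refine isSmooth_of_eventually _ fun x => ?_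
  obtain ⟨t, rfl⟩ := Contratensor.mk_surjective _ _ _ x
  induction t with
  | zero => exact Filter.Eventually.of_forall fun g => by rw [map_zero, map_zero]
  | tmul s p =>
    have h1 : ∀ᶠ g in nhds (1 : G), regLeft k G g s = s :=
      (isSmooth_regLeft s).mem_nhds (by simp)
    filter_upwards [h1] with g hg
    rw [phiRep_mk, hg]
  | add a b ha hb =>
    filter_upwards [ha, hb] with g hg hg'
    rw [map_add, map_add, hg, hg']

/-- The map `k(G) ⊙_{k,G} P → k(G) ⊙_{k,G} Q` induced by a morphism of contramodules. -/
def phiMap {P Q : Contramodule.{w} k G} (f : P ⟶ Q) :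
    (phiRep k G P).IntertwiningMap (phiRep k G Q) where
  toLinearMap := Contratensor.map (.id _) f
  isIntertwining' _ := Contratensor.lin_ext fun _ _ => rfl

/-- The functor `Φ_G = k(G) ⊙_{k,G} -` from `G`-contramodules to smooth `G`-modules. -/
def Phi : Contramodule.{max w u v} k G ⥤ SmoothModule.{max w u v} k G where
  obj P := ⟨Rep.of (phiRep k G P), isSmooth_phiRep k G P⟩
  map f := ObjectProperty.homMk (Rep.ofHom (phiMap k G f))
  map_id _ := ObjectProperty.hom_ext _ (Rep.hom_ext (Representation.IntertwiningMap.ext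
    (Contratensor.lin_ext fun _ _ => rfl)))
  map_comp _ _ := ObjectProperty.hom_ext _ (Rep.hom_ext (Representation.IntertwiningMap.ext
    (Contratensor.lin_ext fun _ _ => rfl)))

variable {k G}

/-- For `s ∈ k(G)`, the locally constant function on `G` whose value at `g` is the evaluation map
`f ↦ f (g s)` on `Hom_{k[G]}(k(G), M)`; here `g s` is the right translation. -/
def evalOrbit {M : Type*} [AddCommGroup M] [Module k M] (σ : Representation k G M) (s : Reg k G) :
    LocallyConstant G ((regLeft k G).IntertwiningMap σ →ₗ[k] M) :=
  (orbit (regRight k G) isSmooth_regRight s).map fun t =>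
    { toFun := fun f => f t
      map_add' := fun _ _ => rfl
      map_smul' := fun _ _ => rfl }

variable (k G)

/-- The contraaction on `Hom_{k[G]}(k(G), M)`: for a measure `μ`, the homomorphism `π(μ)` sends
`s` to the integral of `g ↦ (f ↦ f (g s))` with respect to `μ`. -/
def homPi {M : Type*} [AddCommGroup M] [Module k M] (σ : Representation k G M) :
    Meas k ((regLeft k G).IntertwiningMap σ) G →ₗ[k] (regLeft k G).IntertwiningMap σ where
  toFun μ :=
    { toFun := fun s => Meas.integral (evalOrbit σ s) μ
      map_add' := fun s t => Meas.integral_add_left _ _ _ (fun g => LinearMap.ext fun f => by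
        change f (regRight k G g (s + t)) = f (regRight k G g s) + f (regRight k G g t)
        rw [map_add, map_add]) μ
      map_smul' := fun c s => ((Meas.map_integral (LinearMap.lsmul k M c) _ _
        (fun g => LinearMap.ext fun f => by
          change f (regRight k G g (c • s)) = c • f (regRight k G g s)
          rw [map_smul, map_smul]) μ)).symm
      isIntertwining' := fun g => LinearMap.ext fun s => (Meas.map_integral (σ g) _ _
        (fun h => LinearMap.ext fun f => by
          change f (regRight k G h (regLeft k G g s)) = σ g (f (regRight k G h s))
          rw [← regLeft_regRight, f.isIntertwining]) μ).symm }
  map_add' μ ν := Representation.IntertwiningMap.ext (LinearMap.ext fun s =>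
    map_add (Meas.integralₗ (evalOrbit σ s)) μ ν)
  map_smul' c μ := Representation.IntertwiningMap.ext (LinearMap.ext fun s =>
    map_smul (Meas.integralₗ (evalOrbit σ s)) c μ)

/-- The `G`-contramodule `Hom_{k[G]}(k(G), M)`. The homomorphisms are taken with respect to the
action of `G` on `k(G)` by left translations, and the contraaction comes from the action by right
translations. -/
def homContra {M : Type w} [AddCommGroup M] [Module k M] (σ : Representation k G M) :
    Contramodule.{max w u v} k G where
  V := (regLeft k G).IntertwiningMap σ
  π := homPi k G σ
  contraassoc ν := Representation.IntertwiningMap.ext (LinearMap.ext fun s => by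
    let F : LocallyConstant (G × G) ((regLeft k G).IntertwiningMap σ →ₗ[k] M) :=
      (evalOrbit σ s).comap (mulMap G)
    change Meas.integral (evalOrbit σ s) (Meas.mapValue (homPi k G σ) (Meas.curry ν)) =
      Meas.integral (evalOrbit σ s) (Meas.map (mulMap G) ν)
    rw [Meas.integral_map (mulMap G) _ F (fun _ => rfl),
      ← Meas.integral_curry ((orbit (regRight k G) isSmooth_regRight s).map (evalOrbit σ))
        F (fun g h => LinearMap.ext fun f => ?_)]
    · exact Meas.integral_mapValue _ _ _ (fun g => rfl) _
    · change f (regRight k G (g * h) s) = f (regRight k G g (regRight k G h s))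
      rw [map_mul, Module.End.mul_apply])
  contraunit f := Representation.IntertwiningMap.ext (LinearMap.ext fun s => by
    change Meas.integral (evalOrbit σ s) (Meas.dirac 1 f) = f s
    rw [Meas.integral_dirac]
    change f (regRight k G 1 s) = f s
    rw [map_one, Module.End.one_apply])

/-- Composition with a homomorphism `M → N`, as a morphism of contramodules
`Hom_{k[G]}(k(G), M) → Hom_{k[G]}(k(G), N)`. -/
def homContraMap {M N : Type w} [AddCommGroup M] [Module k M] [AddCommGroup N] [Module k N]
    {σ : Representation k G M} {τ : Representation k G N} (φ : σ.IntertwiningMap τ) :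
    homContra k G σ ⟶ homContra k G τ where
  lin :=
    { toFun := fun f => φ.comp f
      map_add' := fun (f f' : (regLeft k G).IntertwiningMap σ) =>
        Representation.IntertwiningMap.ext (LinearMap.ext fun s => map_add φ (f s) (f' s))
      map_smul' := fun c (f : (regLeft k G).IntertwiningMap σ) =>
        Representation.IntertwiningMap.ext (LinearMap.ext fun s => map_smul φ c (f s)) }
  comm μ := Representation.IntertwiningMap.ext (LinearMap.ext fun s => by
    let F : LocallyConstant G ((regLeft k G).IntertwiningMap σ →ₗ[k] N) :=
      (evalOrbit σ s).map (fun l => φ.toLinearMap ∘ₗ l)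
    exact (Meas.map_integral φ.toLinearMap (evalOrbit σ s) F (fun _ => rfl) μ).trans
      (Meas.integral_mapValue _ (evalOrbit τ s) F (fun _ => rfl) μ).symm)

/-- The functor `Ψ_G = Hom_{k[G]}(k(G), -)` from smooth `G`-modules to `G`-contramodules. -/
def Psi : SmoothModule.{max w u v} k G ⥤ Contramodule.{max w u v} k G where
  obj M := homContra k G M.obj.ρ
  map φ := homContraMap k G φ.hom.hom
  map_id _ := rfl
  map_comp _ _ := rfl

/-! ### The adjunction -/

/-- The map `P → Hom_{k[G]}(k(G), k(G) ⊙_{k,G} P)`, `p ↦ (s ↦ s ⊙ p)`. -/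
def unitLin (P : Contramodule.{w} k G) :
    P.V →ₗ[k] (regLeft k G).IntertwiningMap (phiRep k G P) where
  toFun p :=
    { toLinearMap := Contratensor.mk _ _ P ∘ₗ (TensorProduct.mk k (Reg k G) P.V).flip p
      isIntertwining' := fun _ => rfl }
  map_add' p q := Representation.IntertwiningMap.ext (by
    change _ ∘ₗ _ = _ ∘ₗ _ + _ ∘ₗ _
    rw [map_add, LinearMap.comp_add])
  map_smul' c p := Representation.IntertwiningMap.ext (by
    change _ ∘ₗ _ = c • (_ ∘ₗ _)
    rw [map_smul, LinearMap.comp_smul])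

theorem unitLin_comm (P : Contramodule.{w} k G) (μ : Meas k P.V G) :
    unitLin k G P (P.π μ) = homPi k G (phiRep k G P) (Meas.mapValue (unitLin k G P) μ) := by
  refine Representation.IntertwiningMap.ext (LinearMap.ext fun s => ?_)
  let F : LocallyConstant G (P.V →ₗ[k] Contratensor (regRight k G) isSmooth_regRight P) :=
    (evalOrbit (phiRep k G P) s).map (fun l => l ∘ₗ unitLin k G P)
  refine (Contratensor.mk_pi' (regRight k G) isSmooth_regRight P s μ F (fun _ _ => rfl)).trans ?_
  exact (Meas.integral_mapValue (unitLin k G P) (evalOrbit (phiRep k G P) s) F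
    (fun _ => rfl) μ).symm

/-- The evaluation map `k(G) ⊗ Hom_{k[G]}(k(G), M) → M`. -/
def evalTensor {M : Type*} [AddCommGroup M] [Module k M] (σ : Representation k G M) :
    Reg k G ⊗[k] (regLeft k G).IntertwiningMap σ →ₗ[k] M :=
  TensorProduct.lift (LinearMap.mk₂ k (fun s f => f s)
    (fun s t f => map_add f s t) (fun c s f => map_smul f c s)
    (fun _ _ _ => rfl) (fun _ _ _ => rfl))

/-- The map `k(G) ⊙_{k,G} Hom_{k[G]}(k(G), M) → M`, `s ⊙ f ↦ f(s)`. -/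
def counitMap {M : Type w} [AddCommGroup M] [Module k M] (σ : Representation k G M) :
    (phiRep k G (homContra k G σ)).IntertwiningMap σ where
  toLinearMap := Contratensor.lift (P := homContra k G σ) (evalTensor k G σ) (fun _ _ => rfl)
  isIntertwining' g := Contratensor.lin_ext (fun s (f : (regLeft k G).IntertwiningMap σ) =>
    f.isIntertwining (regLeft k G) σ g s)

/-- The adjunction unit. -/
def unitHom (P : Contramodule.{max w u v} k G) : P ⟶ (Psi.{w} k G).obj ((Phi.{w} k G).obj P) :=
  Contramodule.Hom.mk (Q := homContra k G (phiRep k G P)) (unitLin k G P) (unitLin_comm k G P)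

/-- The adjunction counit. -/
def counitHom (M : SmoothModule.{max w u v} k G) :
    (Phi.{w} k G).obj ((Psi.{w} k G).obj M) ⟶ M :=
  ObjectProperty.homMk (Rep.ofHom (counitMap k G M.obj.ρ))

/-- The adjunction between `Φ_G` and `Ψ_G`. -/
def adjunction : Phi.{w} k G ⊣ Psi.{w} k G where
  unit :=
    { app := unitHom k G
      naturality := fun _ _ _ => rfl }
  counit :=
    { app := counitHom k G
      naturality := fun _ _ _ => ObjectProperty.hom_ext _ (Rep.hom_ext
        (Representation.IntertwiningMap.ext (Contratensor.lin_ext fun _ _ => rfl))) }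
  left_triangle_components _ := ObjectProperty.hom_ext _ (Rep.hom_ext
    (Representation.IntertwiningMap.ext (Contratensor.lin_ext fun _ _ => rfl)))
  right_triangle_components _ := rfl

end Functors

end SemicoSemicontra

end

noncomputable section

namespace SemicoSemicontra

namespace Meas

variable {k : Type*} [Field k] {V : Type*} [AddCommGroup V] [Module k V]
  {W : Type*} [AddCommGroup W] [Module k W] {X : Type*} [TopologicalSpace X]

/-! Everything reduces to a compact open subgroup $H$, where injectives and projectives are retracts
of explicit objects.

Let $H$ be compact. The locally constant functions $H\to V$ form the cofree module coinduced from
the vector space $V$, and every injective module is a retract of one. Applying $\Psi_H$ gives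
$\mathrm{Hom}_k(k(H),V)$. A finitely additive measure on $H$ is the same as a linear map on $k(H)$,
through its values on characteristic functions, so this is $V[[H]]$, the free contramodule on $V$
(`homPi_gen`, `toMeas_homPi`). Every projective is a retract of a free contramodule. The counit at
the cofree module is an isomorphism because $k(H)\odot V[[H]]$ is $k(H)\otimes V$, that is, the
locally constant functions $H\to V$ (`bijective_counitMap_cofree`). A triangle identity then makes
the unit at the free contramodule an isomorphism, and both statements pass to retracts. All lifting
and extension problems come down to linear ones, which are solvable over a field.

For general $G$ and a compact open $H$, the space $k(G)$ is induced from $k(H)$ on either side: a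
compactly supported function is a finite sum of its restrictions to cosets. Frobenius reciprocity
therefore identifies $\Psi_G(M)$ restricted to $H$ with $\Psi_H(M|_H)$ (`bijective_resPsi`), and
likewise $\Phi_H(P|_H)$ with $\Phi_G(P)|_H$ (`bijective_contratensorExt`). For the latter the
inverse is constructed by hand, and checking the contratensor relations requires cutting measures on
$G$ along cosets of $H$. These isomorphisms match the units and counits of $G$ and $H$
(`unit_resPsi`, `phiRes_counit`). Restriction does not change the underlying linear maps, hence it
detects isomorphisms, and the compact case finishes the proof. -/

open Classical in
theorem mapValue_dirac (φ : V →ₗ[k] W) (x : X) (a : V) :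
    mapValue φ (dirac x a) = dirac x (φ a) :=
  Subtype.ext (funext fun U =>
    (apply_ite φ (x ∈ U) a 0).trans (congrArg (ite (x ∈ U) (φ a)) (map_zero φ)))

end Meas

/-! ### Monomorphisms, epimorphisms and isomorphisms -/

section Categories

variable {k : Type u} [Field k] {G : Type v} [Group G] [TopologicalSpace G]

theorem SmoothModule.isIso_of_bijective {M N : SmoothModule.{w} k G} (f : M ⟶ N)
    (hf : Function.Bijective f.hom.hom) : IsIso f := by
  have : IsIso f.hom := by
    have : IsIso ((forget (Rep.{w} k G)).map f.hom) := (isIso_iff_bijective _).2 hf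
    exact isIso_of_reflects_iso f.hom (forget (Rep.{w} k G))
  exact ((isSmooth k G).isoMk (asIso f.hom)).isIso_hom

theorem SmoothModule.bijective_of_isIso {M N : SmoothModule.{w} k G} (f : M ⟶ N) [IsIso f] :
    Function.Bijective f.hom.hom :=
  (isIso_iff_bijective ((forget (Rep.{w} k G)).map f.hom)).1 inferInstance

/-- The kernel is again smooth, so its inclusion and the zero map are test morphisms with equal
composites. -/
theorem SmoothModule.injective_of_mono {M N : SmoothModule.{w} k G} (f : M ⟶ N) [Mono f] :
    Function.Injective f.hom.hom := by
  let S := f.hom.hom.ker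
  let K : SmoothModule.{w} k G := ⟨Rep.of S.toRepresentation, fun x => by
    refine (congrArg IsOpen (Set.ext fun g => ?_)).mpr (M.property x.1)
    exact Subtype.ext_iff⟩
  let i : K ⟶ M := ObjectProperty.homMk (Rep.ofHom ⟨S.toSubmodule.subtype, fun g => rfl⟩)
  let z : K ⟶ M := ObjectProperty.homMk (Rep.ofHom 0)
  have h : i ≫ f = z ≫ f := ObjectProperty.hom_ext _ (Rep.hom_ext
    (Representation.IntertwiningMap.ext (LinearMap.ext fun x =>
      (show f.hom.hom x.1 = 0 from x.2).trans (map_zero f.hom.hom).symm)))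
  have hiz : i = z := (cancel_mono f).1 h
  refine (injective_iff_map_eq_zero f.hom.hom).2 fun x hx => ?_
  exact congrArg (fun j : K ⟶ M => j.hom.hom (⟨x, hx⟩ : S.toSubmodule)) hiz

theorem SmoothModule.mono_of_injective {M N : SmoothModule.{w} k G} (f : M ⟶ N)
    (hf : Function.Injective f.hom.hom) : Mono f where
  right_cancellation _ _ h := ObjectProperty.hom_ext _ (Rep.hom_ext
    (Representation.IntertwiningMap.ext (LinearMap.ext fun x =>
      hf (congrArg (fun j => j.hom.hom x) h))))

variable [IsTopologicalGroup G]

namespace Contramodule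

theorem isIso_of_bijective {P Q : Contramodule.{w} k G} (f : P ⟶ Q)
    (hf : Function.Bijective f.lin) : IsIso f := by
  let e := LinearEquiv.ofBijective f.lin hf
  have he : ∀ x, f.lin (e.symm x) = x := e.apply_symm_apply
  have he' : ∀ x, e.symm (f.lin x) = x := e.symm_apply_apply
  refine ⟨⟨e.symm.toLinearMap, fun μ => hf.1 ?_⟩, Hom.ext (LinearMap.ext he'),
    Hom.ext (LinearMap.ext he)⟩
  refine (he _).trans (Eq.trans (congrArg Q.π ?_) (f.comm _).symm)
  exact Subtype.ext (funext fun U => (he _).symm)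

theorem bijective_of_isIso {P Q : Contramodule.{w} k G} (f : P ⟶ Q) [IsIso f] :
    Function.Bijective f.lin :=
  Function.bijective_iff_has_inverse.2 ⟨(inv f).lin,
    fun x => congrArg (fun j : P ⟶ P => j.lin x) (IsIso.hom_inv_id f),
    fun x => congrArg (fun j : Q ⟶ Q => j.lin x) (IsIso.inv_hom_id f)⟩

theorem epi_of_surjective {P Q : Contramodule.{w} k G} (f : P ⟶ Q)
    (hf : Function.Surjective f.lin) : Epi f where
  left_cancellation _ _ h := Hom.ext (LinearMap.ext fun x => by
    obtain ⟨x, rfl⟩ := hf x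
    exact congrArg (fun j => j.lin x) h)

/-- The contraaction takes measures with values in the range of a morphism to the range. -/
theorem pi_mem_range {P Q : Contramodule.{w} k G} (f : P ⟶ Q) (μ : Meas k Q.V G)
    (hμ : ∀ U, μ.1 U ∈ LinearMap.range f.lin) : Q.π μ ∈ LinearMap.range f.lin := by
  -- Over a field the values of `μ` lift linearly: `t` retracts `Q.V` onto the range and `s` splits
  -- `P.V` over the range. A linear image of a measure is again a measure, so `μ` itself lifts.
  obtain ⟨s, hs⟩ := f.lin.rangeRestrict.exists_rightInverse_of_surjective f.lin.range_rangeRestrict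
  obtain ⟨t, ht⟩ := (LinearMap.range f.lin).subtype.exists_leftInverse_of_injective
    (Submodule.ker_subtype _)
  refine ⟨P.π (Meas.mapValue (s ∘ₗ t) μ), (f.comm _).trans (congrArg Q.π ?_)⟩
  refine Subtype.ext (funext fun U => ?_)
  have h₁ : t (μ.1 U) = ⟨μ.1 U, hμ U⟩ := LinearMap.congr_fun ht ⟨μ.1 U, hμ U⟩
  have h₂ := congrArg Subtype.val (LinearMap.congr_fun hs ⟨μ.1 U, hμ U⟩)
  change f.lin (s (t (μ.1 U))) = μ.1 U
  rw [h₁]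
  exact h₂

/-- This is what makes the contraaction descend to the quotient by the range: the difference of the
two measures takes values in the range. -/
theorem mkQ_pi_congr {P Q : Contramodule.{w} k G} (f : P ⟶ Q) (μ ν : Meas k Q.V G)
    (h : ∀ U, (LinearMap.range f.lin).mkQ (μ.1 U) = (LinearMap.range f.lin).mkQ (ν.1 U)) :
    (LinearMap.range f.lin).mkQ (Q.π μ) = (LinearMap.range f.lin).mkQ (Q.π ν) := by
  refine (Submodule.Quotient.eq _).2 ?_
  rw [← map_sub]
  exact pi_mem_range f _ fun U => (Submodule.Quotient.eq _).1 (h U)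

/-- The cokernel of a morphism of contramodules. -/
def coker {P Q : Contramodule.{w} k G} (f : P ⟶ Q) (s : Q.V ⧸ LinearMap.range f.lin →ₗ[k] Q.V)
    (hs : (LinearMap.range f.lin).mkQ ∘ₗ s = LinearMap.id) : Contramodule.{w} k G :=
  have hs' : ∀ x, (LinearMap.range f.lin).mkQ (s x) = x := LinearMap.congr_fun hs
  { V := Q.V ⧸ LinearMap.range f.lin
    π := (LinearMap.range f.lin).mkQ ∘ₗ Q.π ∘ₗ Meas.mapValue s
    contraassoc := fun ν => by
      refine Eq.trans ?_ (congrArg (LinearMap.range f.lin).mkQ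
        (Q.contraassoc (Meas.mapValue s ν)))
      -- The section `s` is only linear, but it inverts the projection modulo the range, and modulo
      -- the range only the classes of the values matter.
      exact mkQ_pi_congr f _ _ fun U => hs' _
    contraunit := fun x => by
      refine Eq.trans ?_ (hs' x)
      rw [← Q.contraunit (s x)]
      exact congrArg (fun μ => (LinearMap.range f.lin).mkQ (Q.π μ)) (Meas.mapValue_dirac s 1 x) }

/-- The projection to the cokernel and the zero morphism agree after composition with `f`, so they
coincide and the cokernel vanishes. -/
theorem surjective_of_epi {P Q : Contramodule.{w} k G} (f : P ⟶ Q) [Epi f] :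
    Function.Surjective f.lin := by
  obtain ⟨s, hs⟩ := (LinearMap.range f.lin).mkQ.exists_rightInverse_of_surjective
    (Submodule.range_mkQ _)
  have hs' : ∀ x, (LinearMap.range f.lin).mkQ (s x) = x := LinearMap.congr_fun hs
  let q : Q ⟶ coker f s hs := Hom.mk (Q := coker f s hs) (LinearMap.range f.lin).mkQ (fun μ =>
    mkQ_pi_congr f _ _ fun U => (hs' _).symm)
  let z : Q ⟶ coker f s hs := Hom.mk (Q := coker f s hs) 0 (fun μ => by
    refine Eq.trans ?_ (map_zero (coker f s hs).π).symm
    rfl)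
  have h : f ≫ q = f ≫ z := Hom.ext (LinearMap.ext fun x =>
    (Submodule.Quotient.mk_eq_zero _).2 ⟨x, rfl⟩)
  have hqz : q = z := (cancel_epi f).1 h
  intro y
  exact (Submodule.Quotient.mk_eq_zero _).1 (congrArg (fun j : Q ⟶ coker f s hs => j.lin y) hqz)

end Contramodule

end Categories

/-! ### Measures on compact spaces -/

namespace Meas

variable {k : Type*} [Field k] {V : Type*} [AddCommGroup V] [Module k V]
  {X : Type*} [TopologicalSpace X] {Y : Type*} [TopologicalSpace Y]

variable (k V) in
/-- The value of a measure at an open-closed subset, as a linear function of the measure. -/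
def eval (U : Clopens X) : Meas k V X →ₗ[k] V := LinearMap.proj U ∘ₗ (Meas k V X).subtype

variable (k) in
/-- On a compact space every finitely additive measure is compactly supported. -/
def ofAdditive [CompactSpace X] (m : Clopens X → V)
    (hm : ∀ U U', Disjoint U U' → m (U ⊔ U') = m U + m U') : Meas k V X :=
  ⟨m, hm, Set.univ, isCompact_univ, fun U hU => by
    obtain rfl : U = ⊥ := Clopens.ext ((Set.disjoint_univ).1 hU)
    -- Additivity for the pair `⊥`, `⊥` gives `m ⊥ = m ⊥ + m ⊥`.
    simpa using hm ⊥ ⊥ disjoint_bot_left⟩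

/-- Membership in an open-closed subset, as a locally constant predicate. -/
def memLC (U : Clopens X) : LocallyConstant X Prop where
  toFun x := x ∈ U
  isLocallyConstant := by
    refine (IsLocallyConstant.iff_eventually_eq _).2 fun x => ?_
    by_cases hx : x ∈ U
    · filter_upwards [U.isClopen.isOpen.mem_nhds hx] with y hy
      exact propext (iff_of_true hy hx)
    · filter_upwards [U.isClopen.compl.isOpen.mem_nhds hx] with y hy
      exact propext (iff_of_false hy hx)

variable [CompactSpace X]

/-- The slices `{x | (x, y) ∈ W}` of an open-closed subset of `X × Y`. -/
def slice (W : Clopens (X × Y)) : LocallyConstant Y (Clopens X) where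
  toFun y := preimage ⟨fun x => (x, y), by fun_prop⟩ W
  isLocallyConstant := by
    refine (IsLocallyConstant.iff_eventually_eq _).2 fun y => ?_
    -- The tube lemma: compactness of `X` turns local constancy at each `(x, y)` into a single
    -- neighbourhood of `y`.
    have h : ∀ᶠ y' in nhds y, ∀ x ∈ Set.univ, (x, y') ∈ W ↔ (x, y) ∈ W := by
      refine IsCompact.eventually_forall_of_forall_eventually isCompact_univ fun x _ => ?_
      have h₁ : ∀ᶠ p in nhds (x, y), (p ∈ W) = ((x, y) ∈ W) :=
        (IsLocallyConstant.iff_eventually_eq _).1 (memLC W).isLocallyConstant (x, y)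
      have h₂ : ∀ᶠ z : Y × X in nhds (y, x), ((z.2, z.1) ∈ W) = ((x, y) ∈ W) :=
        (continuous_swap.tendsto (y, x)).eventually h₁
      have h₃ : ∀ᶠ z : Y × X in nhds (y, x), ((z.2, y) ∈ W) = ((x, y) ∈ W) :=
        ((by fun_prop : Continuous fun z : Y × X => (z.2, y)).tendsto (y, x)).eventually h₁
      filter_upwards [h₂, h₃] with z hz hz'
      rw [hz, hz']
    filter_upwards [h] with y' hy'
    exact Clopens.ext (Set.ext fun x => hy' x trivial)

variable [CompactSpace Y]

/-- The inverse of `curry` for compact spaces. -/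
def uncurry (ν : Meas k (Meas k V X) Y) : Meas k V (X × Y) :=
  ofAdditive k (fun W => integral ((slice W).map (eval k V)) ν) fun U U' h =>
    integral_add_left _ _ _ (fun y => LinearMap.ext fun μ => by
      refine additive μ (slice U y) (slice U' y) ?_
      rw [← Clopens.coe_disjoint] at h ⊢
      exact h.preimage fun x => (x, y)) ν

/-- The slice of a rectangle `U ×ˢ U'` at `y` is `U` or empty according to whether `y ∈ U'`, so the
integrand takes at most two values and only the fibre `U'` contributes. -/
theorem curry_uncurry (ν : Meas k (Meas k V X) Y) : curry (uncurry ν) = ν := by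
  classical
  refine Subtype.ext (funext fun U' => Subtype.ext (funext fun U => ?_))
  change integral ((slice (U ×ˢ U')).map (eval k V)) ν = (ν.1 U').1 U
  rw [integral_eq_finsum (memLC U') (fun p => if p then eval k V U else 0), finsum_eq_single _ True]
  · rw [if_pos trivial]
    refine congrArg (fun W => (ν.1 W).1 U) (Clopens.ext (Set.ext fun y => ?_))
    exact ⟨of_eq_true, eq_true⟩
  · intro p hp
    rw [if_neg fun h => hp (eq_true h), LinearMap.zero_apply]
  · intro y
    change eval k V (slice (U ×ˢ U') y) = if y ∈ U' then eval k V U else 0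
    split_ifs with hy
    · exact congrArg _ (Clopens.ext (Set.ext fun x => and_iff_left hy))
    · refine LinearMap.ext fun μ => (congrArg μ.1 (?_ : _ = ⊥)).trans (apply_bot μ)
      exact Clopens.ext (Set.eq_empty_of_forall_notMem fun x hx => hy hx.2)

end Meas

/-! ### Cofree smooth modules over compact groups -/

section Cofree

variable (k : Type u) [Field k] (H : Type v) [Group H] [TopologicalSpace H] [IsTopologicalGroup H]
  (V : Type w) [AddCommGroup V] [Module k V]

/-- The action of `H` by left translations on the locally constant functions `H → V`. -/
def cofreeRep : Representation k H (LocallyConstant H V) where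
  toFun g :=
    { toFun := fun a => ⟨fun x => a (g⁻¹ * x),
        a.isLocallyConstant.comp_continuous (continuous_const_mul g⁻¹)⟩
      map_add' := fun _ _ => rfl
      map_smul' := fun _ _ => rfl }
  map_one' := by ext f x; simp
  map_mul' g h := by
    ext f x
    change f ((g * h)⁻¹ * x) = f (h⁻¹ * (g⁻¹ * x))
    rw [mul_inv_rev, mul_assoc]

variable {k H V} in
/-- The homomorphism from a smooth module to a cofree one determined by a linear map. -/
def toCofree {M : Type*} [AddCommGroup M] [Module k M] (ρ : Representation k H M)
    (hρ : IsSmooth ρ) (l : M →ₗ[k] V) : ρ.IntertwiningMap (cofreeRep k H V) where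
  toFun m := ⟨fun h => l (ρ h⁻¹ m),
    ((orbit ρ hρ m).map l).isLocallyConstant.comp_continuous continuous_inv⟩
  map_add' x y := LocallyConstant.ext fun h => by
    change l (ρ h⁻¹ (x + y)) = l (ρ h⁻¹ x) + l (ρ h⁻¹ y)
    rw [map_add, map_add]
  map_smul' c x := LocallyConstant.ext fun h => by
    change l (ρ h⁻¹ (c • x)) = c • l (ρ h⁻¹ x)
    rw [map_smul, map_smul]
  isIntertwining' g := LinearMap.ext fun m => LocallyConstant.ext fun h => by
    change l (ρ h⁻¹ (ρ g m)) = l (ρ (g⁻¹ * h)⁻¹ m)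
    rw [mul_inv_rev, inv_inv, map_mul, Module.End.mul_apply]

variable [CompactSpace H]

/-- Compactness yields one neighbourhood of the unit that works at all points of `H` simultaneously.
-/
theorem isSmooth_cofreeRep : IsSmooth (cofreeRep k H V) := by
  refine isSmooth_of_eventually _ fun a => ?_
  have h₁ : ∀ᶠ g in nhds (1 : H), ∀ x ∈ Set.univ, a (g⁻¹ * x) = a x := by
    refine IsCompact.eventually_forall_of_forall_eventually isCompact_univ fun x _ => ?_
    have hc : IsOpen {p : H × H | a (p.1⁻¹ * p.2) = a x} :=
      (a.isLocallyConstant.isOpen_fiber (a x)).preimage (continuous_fst.inv.mul continuous_snd)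
    have hd : IsOpen {p : H × H | a p.2 = a x} :=
      (a.isLocallyConstant.isOpen_fiber (a x)).preimage continuous_snd
    filter_upwards [hc.mem_nhds (show a ((1 : H)⁻¹ * x) = a x by simp),
      hd.mem_nhds (show a x = a x from rfl)] with p hp hq
    exact Eq.trans hp (Eq.symm hq)
  filter_upwards [h₁] with g hg
  exact LocallyConstant.ext fun x => hg x trivial

/-- The cofree smooth `H`-module cogenerated by a vector space. -/
def cofree : SmoothModule.{max v w} k H := ⟨Rep.of (cofreeRep k H V), isSmooth_cofreeRep k H V⟩

/-- Evaluation at `1` identifies homomorphisms into the cofree module with linear maps to `V`, and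
linear maps extend along injections. -/
instance injective_cofree : Injective (cofree k H V) where
  factors {X Y} g i _ := by
    let g' : X.obj.ρ.IntertwiningMap (cofreeRep k H V) := g.hom.hom
    let l₀ : X.obj.V →ₗ[k] V := (LocallyConstant.evalₗ k (1 : H)) ∘ₗ g'.toLinearMap
    obtain ⟨r, hr⟩ := i.hom.hom.toLinearMap.exists_leftInverse_of_injective
      (LinearMap.ker_eq_bot.2 (SmoothModule.injective_of_mono i))
    refine ⟨ObjectProperty.homMk (Rep.ofHom (toCofree Y.obj.ρ Y.property (l₀ ∘ₗ r))), ?_⟩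
    refine ObjectProperty.hom_ext _ (Rep.hom_ext (Representation.IntertwiningMap.ext
      (LinearMap.ext fun x => LocallyConstant.ext fun h => ?_)))
    change g' (r (Y.obj.ρ h⁻¹ (i.hom.hom x))) 1 = g' x h
    rw [← i.hom.hom.isIntertwining, show ∀ y, r (i.hom.hom y) = y from LinearMap.congr_fun hr,
      g'.isIntertwining]
    change g' x (h⁻¹⁻¹ * 1) = _
    rw [inv_inv, mul_one]

end Cofree

/-! ### Characteristic functions on compact spaces -/

section CharacteristicFunctions

variable {k : Type u} [Field k] {H : Type v} [TopologicalSpace H]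

/-- An element of `k(H)` as a locally constant function. -/
def Reg.toLC (s : Reg k H) : LocallyConstant H k := ⟨s.1, s.2.1⟩

variable [CompactSpace H]

open Classical in
/-- The characteristic function of an open-closed subset of a compact space. -/
def ind (k : Type u) [Field k] (U : Clopens H) : Reg k H :=
  ⟨fun x => if x ∈ U then 1 else 0,
    (Meas.memLC U).isLocallyConstant.comp fun p => if p then (1 : k) else 0,
    (isClosed_tsupport _).isCompact⟩

theorem ind_sup (k : Type u) [Field k] (U U' : Clopens H) (h : Disjoint U U') :
    ind k (U ⊔ U') = ind k U + ind k U' := by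
  classical
  refine Subtype.ext (funext fun x => ?_)
  have hs : x ∈ U ⊔ U' ↔ x ∈ U ∨ x ∈ U' := Iff.rfl
  change (if x ∈ U ⊔ U' then (1 : k) else 0) =
    (if x ∈ U then 1 else 0) + if x ∈ U' then 1 else 0
  have h' : x ∈ U → x ∉ U' := fun h₁ h₂ => Set.disjoint_left.1 (Clopens.coe_disjoint.2 h) h₁ h₂
  by_cases h₁ : x ∈ U
  · simp [hs, h₁, h' h₁]
  · simp [hs, h₁]

theorem Reg.finite_support_fibre (s : Reg k H) :
    (Function.support fun c : k => c • ind k (Meas.fibre (Reg.toLC s) c)).Finite := by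
  classical
  refine (Reg.toLC s).range_finite.subset fun c hc => ?_
  by_contra hn
  refine hc ?_
  have : ind k (Meas.fibre (Reg.toLC s) c) = 0 :=
    Subtype.ext (funext fun x => if_neg fun h => hn ⟨x, h⟩)
  change c • ind k (Meas.fibre (Reg.toLC s) c) = 0
  rw [this, smul_zero]

/-- Every locally constant function is a linear combination of characteristic functions. -/
theorem Reg.eq_finsum (s : Reg k H) : s = ∑ᶠ c : k, c • ind k (Meas.fibre (Reg.toLC s) c) := by
  classical
  refine Subtype.ext (funext fun x => ?_)
  let l : Reg k H →ₗ[k] k := LinearMap.proj x ∘ₗ (Reg k H).subtype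
  change l s = l _
  rw [map_finsum l (Reg.finite_support_fibre s), finsum_eq_single _ (s.1 x)]
  · change s.1 x = s.1 x • (if s.1 x = s.1 x then (1 : k) else 0)
    simp
  · intro c hc
    change c • (if s.1 x = c then (1 : k) else 0) = 0
    simp [Ne.symm hc]

/-- Measures are linear maps on `k(H)`: one that agrees with `l` on characteristic functions
integrates every `s` to `l s`, since `s` is a finite combination of these. -/
theorem Meas.integral_smul_id {V : Type w} [AddCommGroup V] [Module k V] (l : Reg k H →ₗ[k] V)
    (μ : Meas k V H) (hμ : ∀ U, μ.1 U = l (ind k U)) (s : Reg k H) (F : LocallyConstant H (V →ₗ[k] V))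
    (hF : ∀ x v, F x v = s.1 x • v) : Meas.integral F μ = l s := by
  rw [Meas.integral_eq_finsum (Reg.toLC s) (fun c => c • LinearMap.id) F
    (fun x => LinearMap.ext (hF x))]
  conv_rhs => rw [Reg.eq_finsum s]
  rw [map_finsum l (Reg.finite_support_fibre s)]
  refine finsum_congr fun c => ?_
  rw [map_smul, ← hμ]
  rfl

end CharacteristicFunctions

/-! ### Free contramodules over compact groups -/

section Free

variable (k : Type u) [Field k] (H : Type v) [Group H] [TopologicalSpace H] [IsTopologicalGroup H]
  (V : Type w) [AddCommGroup V] [Module k V]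

/-- The homomorphisms `s ↦ s v` from `k(H)` to the cofree module, which freely generate the
contramodule of all homomorphisms. -/
def gen : V →ₗ[k] (regLeft k H).IntertwiningMap (cofreeRep k H V) where
  toFun v :=
    { toFun := fun s => (Reg.toLC s).map (· • v)
      map_add' := fun s t => LocallyConstant.ext fun x => add_smul (s.1 x) (t.1 x) v
      map_smul' := fun c s => LocallyConstant.ext fun x => mul_smul c (s.1 x) v
      isIntertwining' := fun _ => rfl }
  map_add' v w := Representation.IntertwiningMap.ext (LinearMap.ext fun s =>
    LocallyConstant.ext fun x => smul_add (s.1 x) v w)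
  map_smul' c v := Representation.IntertwiningMap.ext (LinearMap.ext fun s =>
    LocallyConstant.ext fun x => smul_comm (s.1 x) c v)

variable [CompactSpace H]

/-- The measure `U ↦ f(1_U)(1)` corresponding to a homomorphism from `k(H)` to the cofree
module. -/
def toMeas : (regLeft k H).IntertwiningMap (cofreeRep k H V) →ₗ[k] Meas k V H where
  toFun f := Meas.ofAdditive k (fun U => f (ind k U) 1) fun U U' h => by
    rw [ind_sup k U U' h, map_add]
    rfl
  map_add' _ _ := rfl
  map_smul' _ _ := rfl

theorem toMeas_gen (v : V) : toMeas k H V (gen k H V v) = Meas.dirac 1 v := by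
  classical
  refine Subtype.ext (funext fun U => ?_)
  change (if (1 : H) ∈ U then (1 : k) else 0) • v = if (1 : H) ∈ U then v else 0
  rw [ite_smul, one_smul, zero_smul]

/-- Shows that the elements `gen v` generate. By equivariance `f` is determined by the linear map `s
↦ f s 1`, which is integration against `toMeas f`. -/
theorem homPi_gen (f : (regLeft k H).IntertwiningMap (cofreeRep k H V)) :
    homPi k H (cofreeRep k H V) (Meas.mapValue (gen k H V) (toMeas k H V f)) = f := by
  refine Representation.IntertwiningMap.ext (LinearMap.ext fun s => LocallyConstant.ext fun x => ?_)
  let l : LocallyConstant H V →ₗ[k] V := LocallyConstant.evalₗ k x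
  let F : LocallyConstant H (V →ₗ[k] V) :=
    (evalOrbit (cofreeRep k H V) s).map fun φ => l ∘ₗ φ ∘ₗ gen k H V
  change l (Meas.integral (evalOrbit _ s) _) = f s x
  rw [Meas.map_integral l _ ((evalOrbit (cofreeRep k H V) s).map fun φ => l ∘ₗ φ) (fun _ => rfl),
    Meas.integral_mapValue _ _ F (fun _ => rfl)]
  let l₁ : Reg k H →ₗ[k] V := LocallyConstant.evalₗ k (1 : H) ∘ₗ f.toLinearMap
  -- After evaluation at `x` the integrand is multiplication by `s (x * y)`, the left translate of
  -- `s` by `x⁻¹`.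
  rw [Meas.integral_smul_id l₁ _ (fun _ => rfl) (regLeft k H x⁻¹ s)]
  · change f (regLeft k H x⁻¹ s) 1 = f s x
    rw [f.isIntertwining]
    change f s (x⁻¹⁻¹ * 1) = _
    rw [inv_inv, mul_one]
  · intro y v
    change s.1 (x * y) • v = s.1 (x⁻¹⁻¹ * y) • v
    rw [inv_inv]

/-- Through `toMeas` the contraaction becomes the standard one on `V[[H]]`, convolution of measures.
Both sides integrate the same function, since the right translate of `1_U` by `g` is the
characteristic function of the slice `{x | x * g ∈ U}`. -/
theorem toMeas_homPi (ν : Meas k ((regLeft k H).IntertwiningMap (cofreeRep k H V)) H) :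
    toMeas k H V (homPi k H (cofreeRep k H V) ν) =
      Meas.map (mulMap H) (Meas.uncurry (Meas.mapValue (toMeas k H V) ν)) := by
  refine Subtype.ext (funext fun U => ?_)
  let l : LocallyConstant H V →ₗ[k] V := LocallyConstant.evalₗ k 1
  let F := (evalOrbit (cofreeRep k H V) (ind k U)).map fun φ => l ∘ₗ φ
  refine (Meas.map_integral l (evalOrbit _ (ind k U)) F (fun _ => rfl) ν).trans ?_
  exact (Meas.integral_mapValue _ _ F (fun _ => rfl) ν).symm

end Free

/-! ### Universal property and projectivity of free contramodules. -/

section FreeContramodule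

variable (k : Type u) [Field k] (H : Type v) [Group H] [TopologicalSpace H] [IsTopologicalGroup H]
  [CompactSpace H] (V : Type (max w u v)) [AddCommGroup V] [Module k V]

/-- The free contramodule over a compact group generated by a vector space. -/
def free : Contramodule.{max w u v} k H := (Psi.{w} k H).obj (cofree k H V)

variable {k H V}

/-- The morphism from a free contramodule determined by a linear map. -/
def freeLift {P : Contramodule.{max w u v} k H} (l : V →ₗ[k] P.V) : free.{w} k H V ⟶ P :=
  Contramodule.Hom.mk (P := homContra k H (cofreeRep k H V))
    (P.π ∘ₗ Meas.mapValue l ∘ₗ toMeas k H V) (fun ν => by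
      refine (congrArg (fun μ => P.π (Meas.mapValue l μ)) (toMeas_homPi k H V ν)).trans ?_
      refine (P.contraassoc
        (Meas.mapValue l (Meas.uncurry (Meas.mapValue (toMeas k H V) ν)))).symm.trans ?_
      exact congrArg (fun ν' => P.π (Meas.mapValue P.π (Meas.mapValue (Meas.mapValue l) ν')))
        (Meas.curry_uncurry (Meas.mapValue (toMeas k H V) ν)))

theorem freeLift_gen {P : Contramodule.{max w u v} k H} (l : V →ₗ[k] P.V) (v : V) :
    (freeLift l).lin (gen k H V v) = l v := by
  change P.π (Meas.mapValue l (toMeas k H V (gen k H V v))) = l v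
  rw [toMeas_gen, Meas.mapValue_dirac, P.contraunit]

/-- Every element is the contraaction of a measure with values in the generators, and morphisms
commute with contraactions. -/
theorem free_hom_ext {P : Contramodule.{max w u v} k H} {f g : free.{w} k H V ⟶ P}
    (h : ∀ v, f.lin (gen k H V v) = g.lin (gen k H V v)) : f = g := by
  refine Contramodule.Hom.ext (LinearMap.ext fun x => ?_)
  have hx := homPi_gen k H V x
  rw [← hx]
  refine (f.comm _).trans (Eq.trans (congrArg P.π ?_) (g.comm _).symm)
  exact Subtype.ext (funext fun U => h _)

/-- An epimorphism is surjective, so the images of the generators lift linearly, and the universal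
property does the rest. -/
instance projective_free : Projective (free.{w} k H V) where
  factors {P Q} g e _ := by
    obtain ⟨s, hs⟩ := e.lin.exists_rightInverse_of_surjective
      (LinearMap.range_eq_top.2 (Contramodule.surjective_of_epi e))
    refine ⟨freeLift (s ∘ₗ g.lin ∘ₗ gen k H V), free_hom_ext fun v => ?_⟩
    refine (congrArg e.lin (freeLift_gen _ v)).trans ?_
    exact LinearMap.congr_fun hs _

theorem epi_freeLift (P : Contramodule.{max w u v} k H) :
    Epi (freeLift.{w} (LinearMap.id : P.V →ₗ[k] P.V)) :=
  Contramodule.epi_of_surjective _ fun p => ⟨gen k H P.V p, freeLift_gen _ p⟩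

end FreeContramodule

/-! ### The equivalence for compact groups -/

section CofreeCounit

variable (k : Type u) [Field k] (H : Type v) [Group H] [TopologicalSpace H] [IsTopologicalGroup H]
  (V : Type w) [AddCommGroup V] [Module k V]

/-- The map `k(H) ⊗ V → V^H` to the locally constant functions, `s ⊗ v ↦ s v`. -/
def tensorToLC : Reg k H ⊗[k] V →ₗ[k] LocallyConstant H V :=
  TensorProduct.lift (LinearMap.mk₂ k (fun s v => gen k H V v s)
    (fun s t v => map_add (gen k H V v) s t) (fun c s v => map_smul (gen k H V v) c s)
    (fun s v w => by rw [map_add]; rfl) (fun c s v => by rw [map_smul]; rfl))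

theorem tensorToLC_tmul (s : Reg k H) (v : V) (x : H) :
    tensorToLC k H V (s ⊗ₜ[k] v) x = s.1 x • v := rfl

/-- In a basis of `V` a tensor is a finite family of elements of `k(H)`, which are read off
pointwise as the coordinates of the image. -/
theorem tensorToLC_injective : Function.Injective (tensorToLC k H V) := by
  classical
  let b := Module.Basis.ofVectorSpace k V
  let e := TensorProduct.equivFinsuppOfBasisRight (M := Reg k H) b
  refine (injective_iff_map_eq_zero _).2 fun t ht => ?_
  obtain ⟨f, rfl⟩ := e.symm.surjective t
  suffices h : f = 0 by rw [h, map_zero]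
  have key : ∀ (f : _ →₀ Reg k H) (x : H) i,
      b.repr (tensorToLC k H V (e.symm f) x) i = (f i).1 x := by
    intro f x i
    let l₁ : (_ →₀ Reg k H) →ₗ[k] k := b.coord i ∘ₗ LocallyConstant.evalₗ k x ∘ₗ
      tensorToLC k H V ∘ₗ e.symm.toLinearMap
    let l₂ : (_ →₀ Reg k H) →ₗ[k] k := LinearMap.proj x ∘ₗ (Reg k H).subtype ∘ₗ Finsupp.lapply i
    suffices h : l₁ = l₂ from LinearMap.congr_fun h f
    refine Finsupp.lhom_ext fun j s => ?_
    change b.repr (tensorToLC k H V (e.symm (Finsupp.single j s)) x) i = (Finsupp.single j s i).1 x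
    rw [show e.symm (Finsupp.single j s) = s ⊗ₜ[k] b j from
        (TensorProduct.equivFinsuppOfBasisRight_symm_apply b _).trans
          (Finsupp.sum_single_index (TensorProduct.zero_tmul _ _)),
      tensorToLC_tmul, map_smul, b.repr_self, Finsupp.smul_apply]
    by_cases hij : j = i
    · subst hij; simp
    · simp [hij]
  refine Finsupp.ext fun i => Subtype.ext (funext fun x => ?_)
  rw [← key, ht]
  change b.repr 0 i = 0
  rw [map_zero, Finsupp.zero_apply]

variable [CompactSpace H]

/-- A locally constant function on a compact space has finitely many values, so it is a finite sum
of characteristic functions of fibres times values. -/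
theorem tensorToLC_surjective : Function.Surjective (tensorToLC k H V) := by
  classical
  intro a
  have hfin : (Function.support fun v : V => ind k (Meas.fibre a v) ⊗ₜ[k] v).Finite := by
    refine a.range_finite.subset fun v hv => ?_
    by_contra hn
    refine hv ?_
    have : ind k (Meas.fibre a v) = 0 :=
      Subtype.ext (funext fun x => if_neg fun h => hn ⟨x, h⟩)
    change ind k (Meas.fibre a v) ⊗ₜ[k] v = 0
    rw [this, TensorProduct.zero_tmul]
  refine ⟨∑ᶠ v : V, ind k (Meas.fibre a v) ⊗ₜ[k] v, LocallyConstant.ext fun x => ?_⟩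
  let l : Reg k H ⊗[k] V →ₗ[k] V := LocallyConstant.evalₗ k x ∘ₗ tensorToLC k H V
  change l _ = a x
  rw [map_finsum l hfin, finsum_eq_single _ (a x)]
  · change (if a x = a x then (1 : k) else 0) • a x = a x
    simp
  · intro v hv
    change (if a x = v then (1 : k) else 0) • v = 0
    simp [Ne.symm hv]

/-- The map `k(H) ⊗ V → k(H) ⊙_{k,H} F`, where `F` is the free contramodule generated by `V`. -/
def tensorToContratensor : Reg k H ⊗[k] V →ₗ[k]
    Contratensor (regRight k H) isSmooth_regRight (homContra k H (cofreeRep k H V)) :=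
  Contratensor.mk (regRight k H) isSmooth_regRight (homContra k H (cofreeRep k H V)) ∘ₗ
    TensorProduct.map LinearMap.id (gen k H V)

/-- Since `f` is the contraaction of a measure on generators, the defining relation rewrites `s ⊙ f`
as an integral of terms `g s ⊙ gen v`. That integral is a finite sum, so it comes from `k(H) ⊗ V`.
-/
theorem tensorToContratensor_surjective : Function.Surjective (tensorToContratensor k H V) := by
  refine LinearMap.range_eq_top.1 (top_le_iff.1 ?_)
  rintro x -
  obtain ⟨t, rfl⟩ := Contratensor.mk_surjective _ _ _ x
  induction t with
  | zero => rw [map_zero]; exact zero_mem _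
  | add a b ha hb => rw [map_add]; exact add_mem ha hb
  | tmul s f =>
    let μ := toMeas k H V f
    let F := (orbit (regRight k H) isSmooth_regRight s).map (TensorProduct.mk k (Reg k H) V)
    let F' := F.map fun φ => tensorToContratensor k H V ∘ₗ φ
    refine ⟨Meas.integral F μ, ?_⟩
    refine (Meas.map_integral (Z := Reg k H ⊗[k] V) (Z' := Contratensor (regRight k H)
      isSmooth_regRight (homContra k H (cofreeRep k H V))) (tensorToContratensor k H V) F F'
      (fun _ => rfl) μ).trans ?_
    let E := (orbit (regRight k H) isSmooth_regRight s).map fun t =>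
      Contratensor.mk (regRight k H) isSmooth_regRight (homContra k H (cofreeRep k H V)) ∘ₗ
        TensorProduct.mk k (Reg k H) (homContra k H (cofreeRep k H V)).V t
    refine (Meas.integral_mapValue (gen k H V) E F' (fun _ => rfl) μ).symm.trans ?_
    refine (Contratensor.mk_pi' (regRight k H) isSmooth_regRight
      (homContra k H (cofreeRep k H V)) s _ E (fun _ _ => rfl)).symm.trans ?_
    exact congrArg (fun f => Contratensor.mk (regRight k H) isSmooth_regRight
      (homContra k H (cofreeRep k H V)) (s ⊗ₜ[k] f)) (homPi_gen k H V f)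

/-- The surjection `tensorToContratensor` followed by the counit is the bijection `tensorToLC`, so
both factors are bijective. -/
theorem bijective_counitMap_cofree :
    Function.Bijective (counitMap k H (cofreeRep k H V)) := by
  have h : ∀ t, counitMap k H (cofreeRep k H V) (tensorToContratensor k H V t) =
      tensorToLC k H V t := by
    refine LinearMap.congr_fun (f := (counitMap k H (cofreeRep k H V)).toLinearMap ∘ₗ
      tensorToContratensor k H V) (TensorProduct.ext' fun s v => rfl)
  constructor
  · refine (injective_iff_map_eq_zero _).2 fun x hx => ?_
    obtain ⟨t, rfl⟩ := tensorToContratensor_surjective k H V x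
    rw [h] at hx
    rw [(injective_iff_map_eq_zero _).1 (tensorToLC_injective k H V) t hx, map_zero]
  · intro a
    obtain ⟨t, rfl⟩ := tensorToLC_surjective k H V a
    exact ⟨_, h t⟩

end CofreeCounit

/-! ### Passage from cofree and free objects to their retracts. -/

section Compact

variable {k : Type u} [Field k] {H : Type v} [Group H] [TopologicalSpace H] [IsTopologicalGroup H]
  [CompactSpace H]

instance isIso_counit_cofree (V : Type (max w u v)) [AddCommGroup V] [Module k V] :
    IsIso ((adjunction.{w} k H).counit.app (cofree k H V)) :=
  SmoothModule.isIso_of_bijective _ (bijective_counitMap_cofree k H V)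

/-- The free contramodule is `Psi` of a cofree module, so a triangle identity makes the unit a
right-cancellable factor of the identity, the other factor being `Psi` of an invertible counit. -/
instance isIso_unit_free (V : Type (max w u v)) [AddCommGroup V] [Module k V] :
    IsIso ((adjunction.{w} k H).unit.app (free.{w} k H V)) := by
  have h := (adjunction.{w} k H).right_triangle_components (cofree k H V)
  have h₁ : IsIso ((adjunction.{w} k H).counit.app (cofree k H V)) := isIso_counit_cofree.{w} V
  have h₂ : IsIso ((Psi.{w} k H).map ((adjunction.{w} k H).counit.app (cofree k H V))) :=
    inferInstance
  have h₃ : IsIso (𝟙 ((Psi.{w} k H).obj (cofree k H V))) := inferInstance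
  exact @IsIso.of_isIso_fac_right _ _ _ _ _ _ _ _ h₂ h₃ h

/-- An injective module over a compact group is a retract of a cofree one. -/
theorem nonempty_retract_cofree (M : SmoothModule.{max w u v} k H) [Injective M] :
    Nonempty (Retract M (cofree k H M.obj.V)) := by
  let i : M ⟶ cofree k H M.obj.V :=
    ObjectProperty.homMk (Rep.ofHom (toCofree M.obj.ρ M.property LinearMap.id))
  have : Mono i := SmoothModule.mono_of_injective i fun x y hxy => by
    have h : M.obj.ρ 1⁻¹ x = M.obj.ρ 1⁻¹ y :=
      congrArg (fun a : LocallyConstant H M.obj.V => a 1) hxy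
    simpa using h
  exact ⟨⟨i, Injective.factorThru (𝟙 M) i, Injective.comp_factorThru _ _⟩⟩

/-- A projective contramodule over a compact group is a retract of a free one. -/
theorem nonempty_retract_free (P : Contramodule.{max w u v} k H) [Projective P] :
    Nonempty (Retract P (free.{w} k H P.V)) := by
  have := epi_freeLift.{w} P
  exact ⟨⟨Projective.factorThru (𝟙 P) (freeLift.{w} LinearMap.id), freeLift.{w} LinearMap.id,
    Projective.factorThru_comp _ _⟩⟩

/-- By naturality the counit at `M` is a retract, as an arrow, of the counit at a cofree module. -/
theorem isIso_counit_of_injective (M : SmoothModule.{max w u v} k H) [Injective M] :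
    IsIso ((adjunction.{w} k H).counit.app M) := by
  obtain ⟨r⟩ := nonempty_retract_cofree.{w} M
  exact (MorphismProperty.isomorphisms _).of_retract
    (NatTrans.retractArrowApp _ r) (isIso_counit_cofree M.obj.V)

theorem isIso_unit_of_projective (P : Contramodule.{max w u v} k H) [Projective P] :
    IsIso ((adjunction.{w} k H).unit.app P) := by
  obtain ⟨r⟩ := nonempty_retract_free.{w} P
  exact (MorphismProperty.isomorphisms _).of_retract
    (NatTrans.retractArrowApp _ r) (isIso_unit_free P.V)

theorem projective_psi (M : SmoothModule.{max w u v} k H) [Injective M] :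
    Projective ((Psi.{w} k H).obj M) := by
  obtain ⟨r⟩ := nonempty_retract_cofree.{w} M
  exact Retract.projective (r.map (Psi.{w} k H)) (p := projective_free.{w} (V := M.obj.V))

theorem injective_phi (P : Contramodule.{max w u v} k H) [Projective P] :
    Injective ((Phi.{w} k H).obj P) := by
  obtain ⟨r⟩ := nonempty_retract_free.{w} P
  have : Injective ((Phi.{w} k H).obj (free.{w} k H P.V)) :=
    Injective.of_iso (asIso ((adjunction.{w} k H).counit.app (cofree k H P.V))).symm inferInstance
  exact (r.map (Phi.{w} k H)).injective

end Compact

/-! ### Restriction to a compact open subgroup -/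

section Cosets

variable {G : Type v} [Group G] [TopologicalSpace G] [IsTopologicalGroup G] {H : Subgroup G}

/-- The projection to the cosets of an open subgroup is locally constant. -/
def cosetLC (ho : IsOpen (H : Set G)) : LocallyConstant G (G ⧸ H) where
  toFun x := x
  isLocallyConstant := (IsLocallyConstant.iff_exists_open _).2 fun x =>
    ⟨(fun y => x⁻¹ * y) ⁻¹' H, ho.preimage (continuous_const_mul x⁻¹), by simp [H.one_mem],
      fun _ hy => (QuotientGroup.eq.2 hy).symm⟩

/-- The translation `h ↦ d h` from a subgroup to the group. -/
def cosetMap (H : Subgroup G) (d : G) : C(H, G) :=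
  ⟨fun h => d * h, continuous_subtype_val.const_mul d⟩

/-- The translate `d U` of an open-closed subset of an open subgroup. -/
def cosetImage (ho : IsOpen (H : Set G)) (d : G) (U : Clopens H) : Clopens G :=
  ⟨cosetMap H d '' U,
    ((Homeomorph.mulLeft d).isClosedEmbedding.comp
      (H.isClosed_of_isOpen ho).isClosedEmbedding_subtypeVal).isClosedMap _ U.isClopen.isClosed,
    ((Homeomorph.mulLeft d).isOpenEmbedding.comp
      ho.isOpenEmbedding_subtypeVal).isOpenMap _ U.isClopen.isOpen⟩

theorem cosetMap_injective (d : G) : Function.Injective (cosetMap H d) :=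
  fun _ _ h => Subtype.ext (mul_left_cancel h)

variable {k : Type u} [Field k] {V : Type w} [AddCommGroup V] [Module k V] [CompactSpace H]

/-- A measure on `G` is a sum of measures concentrated on cosets of an open subgroup. -/
theorem Meas.mem_of_cosetMap_mem (ho : IsOpen (H : Set G)) (S : Submodule k (Meas k V G))
    (hS : ∀ (d : G) (μ : Meas k V H), Meas.map (cosetMap H d) μ ∈ S) (μ : Meas k V G) : μ ∈ S := by
  classical
  -- The compact support meets only finitely many of the open cosets. Below, `m q` is the part of
  -- `μ` on the coset `q`, moved to `H` by the representative `q.out`.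
  obtain ⟨s, hs⟩ := Meas.exists_finset (cosetLC ho) μ
  let m (q : G ⧸ H) : Meas k V H := Meas.ofAdditive k (fun U => μ.1 (cosetImage ho q.out U))
    fun U U' h => by
      rw [← Meas.additive μ]
      · exact congrArg μ.1 (Clopens.ext (Set.image_union _ _ _))
      · rw [← Clopens.coe_disjoint] at h ⊢
        exact (Set.disjoint_image_iff (cosetMap_injective _)).2 h
  suffices h : μ = ∑ q ∈ s, Meas.map (cosetMap H q.out) (m q) by
    rw [h]
    exact sum_mem fun q _ => hS _ _
  refine Subtype.ext (funext fun U => ?_)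
  have h₁ : (∑ q ∈ s, Meas.map (cosetMap H q.out) (m q)).1 U =
      ∑ q ∈ s, μ.1 (U ⊓ Meas.fibre (cosetLC ho) q) := by
    refine (map_sum (Meas.eval k V U) _ _).trans (Finset.sum_congr rfl fun q _ => ?_)
    refine congrArg μ.1 (Clopens.ext (Set.ext fun x => ?_))
    constructor
    · rintro ⟨h, hU, rfl⟩
      refine ⟨hU, ?_⟩
      change ((q.out * h : G) : G ⧸ H) = q
      rw [QuotientGroup.mk_mul_of_mem _ h.2, QuotientGroup.out_eq']
    · rintro ⟨hU, hq⟩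
      have hq' : (q.out : G ⧸ H) = (x : G ⧸ H) := (QuotientGroup.out_eq' q).trans hq.symm
      have hx : q.out * (q.out⁻¹ * x) = x := mul_inv_cancel_left _ _
      refine ⟨⟨q.out⁻¹ * x, QuotientGroup.eq.1 hq'⟩, ?_, hx⟩
      change q.out * (q.out⁻¹ * x) ∈ U
      rwa [hx]
  rw [h₁, ← Meas.apply_finset_sup μ s fun q => U ⊓ Meas.fibre (cosetLC ho) q,
    ← Finset.sup_inf_distrib_left]
  · conv_lhs => rw [← sup_inf_sdiff U (s.sup (Meas.fibre (cosetLC ho)))]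
    rw [Meas.additive μ _ _ disjoint_inf_sdiff, hs (U \ _), add_zero]
    rintro x ⟨-, hx⟩ hxs
    refine hx ?_
    rw [Clopens.coe_finset_sup]
    exact Set.mem_iUnion₂.2 ⟨_, hxs, rfl⟩
  · intro a _ b _ hab
    rw [← Clopens.coe_disjoint, Set.disjoint_left]
    rintro x ⟨-, rfl⟩ ⟨-, hx⟩
    exact hab hx

end Cosets

/-! ### Extension by zero, and `k(G)` as a module induced from `k(H)`. -/

section Extension

variable {k : Type u} [Field k] {G : Type v} [Group G] [TopologicalSpace G] [IsTopologicalGroup G]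
  {H : Subgroup G} [CompactSpace H]

open Classical in
/-- Extension by zero from a compact open subgroup. -/
def extReg (ho : IsOpen (H : Set G)) : Reg k H →ₗ[k] Reg k G where
  toFun s := ⟨fun x => if h : x ∈ H then s.1 ⟨x, h⟩ else 0, by
    have hH : IsClosed (H : Set G) := H.isClosed_of_isOpen ho
    refine ⟨(IsLocallyConstant.iff_eventually_eq _).2 fun x => ?_, ?_⟩
    · by_cases hx : x ∈ H
      · have h := (IsLocallyConstant.iff_eventually_eq _).1 s.2.1 ⟨x, hx⟩
        have h' := ho.isOpenEmbedding_subtypeVal.map_nhds_eq ⟨x, hx⟩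
        change ∀ᶠ y in nhds x, _
        rw [show nhds x = _ from h'.symm, Filter.eventually_map]
        filter_upwards [h] with y hy
        rw [dif_pos hx]
        exact (dif_pos y.2).trans hy
      · filter_upwards [hH.isOpen_compl.mem_nhds hx] with y hy
        rw [dif_neg hx]
        exact dif_neg hy
    · refine (isCompact_iff_compactSpace.2 ‹_› : IsCompact (H : Set G)).of_isClosed_subset
        (isClosed_tsupport _) (closure_minimal (fun x hx => ?_) hH)
      by_contra hn
      exact hx (dif_neg hn)⟩
  map_add' s t := Subtype.ext (funext fun x => by
    by_cases h : x ∈ H <;> simp [h])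
  map_smul' c s := Subtype.ext (funext fun x => by
    by_cases h : x ∈ H <;> simp [h])

theorem extReg_of_mem (ho : IsOpen (H : Set G)) (s : Reg k H) (x : H) :
    (extReg ho s).1 x = s.1 x := dif_pos x.2

theorem extReg_of_notMem (ho : IsOpen (H : Set G)) (s : Reg k H) (x : G) (hx : x ∉ H) :
    (extReg ho s).1 x = 0 := dif_neg hx

theorem extReg_regLeft (ho : IsOpen (H : Set G)) (h : H) (s : Reg k H) :
    extReg ho (regLeft k H h s) = regLeft k G h (extReg ho s) := by
  refine Subtype.ext (funext fun x => ?_)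
  change _ = (extReg ho s).1 ((h⁻¹ : H) * x)
  by_cases hx : x ∈ H
  · exact (extReg_of_mem ho (regLeft k H h s) ⟨x, hx⟩).trans
      (extReg_of_mem ho s (h⁻¹ * (⟨x, hx⟩ : H))).symm
  · rw [extReg_of_notMem ho _ x hx, extReg_of_notMem ho]
    rwa [H.mul_mem_cancel_left (h⁻¹).2]

theorem extReg_regRight (ho : IsOpen (H : Set G)) (h : H) (s : Reg k H) :
    extReg ho (regRight k H h s) = regRight k G h (extReg ho s) := by
  refine Subtype.ext (funext fun x => ?_)
  change _ = (extReg ho s).1 (x * h)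
  by_cases hx : x ∈ H
  · exact (extReg_of_mem ho (regRight k H h s) ⟨x, hx⟩).trans
      (extReg_of_mem ho s ((⟨x, hx⟩ : H) * h)).symm
  · rw [extReg_of_notMem ho _ x hx, extReg_of_notMem ho]
    rwa [H.mul_mem_cancel_right h.2]

variable (k H) in
/-- Restriction of functions to a compact subgroup. -/
def resReg : Reg k G →ₗ[k] Reg k H where
  toFun s := ⟨fun x => s.1 x, s.2.1.comp_continuous continuous_subtype_val,
    (isClosed_tsupport _).isCompact⟩
  map_add' _ _ := rfl
  map_smul' _ _ := rfl

/-! ### Extending equivariant maps from `k(H)` to `k(G)` -/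

variable {Z : Type*} [AddCommGroup Z] [Module k Z] (σ : Representation k G Z)
  (θ : (regLeft k H).IntertwiningMap (σ.comp H.subtype))

/-- The contribution of the coset `x H` to the equivariant extension of `θ`. -/
def cosetTerm (x : G) : Reg k G →ₗ[k] Z :=
  σ x ∘ₗ θ.toLinearMap ∘ₗ resReg k H ∘ₗ regLeft k G x⁻¹

/-- Equivariance of `θ` under `H` cancels the change of representative, so the sum over cosets is
independent of choices. -/
theorem cosetTerm_mul (x : G) (h : H) : cosetTerm σ θ (x * h) = cosetTerm σ θ x := by
  refine LinearMap.ext fun s => ?_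
  have h₁ : resReg k H (regLeft k G (x * h)⁻¹ s) =
      regLeft k H h⁻¹ (resReg k H (regLeft k G x⁻¹ s)) :=
    Subtype.ext (funext fun y => congrArg s.1 (by simp [mul_assoc]))
  change σ (x * h) (θ (resReg k H (regLeft k G (x * h)⁻¹ s))) =
    σ x (θ (resReg k H (regLeft k G x⁻¹ s)))
  rw [h₁, θ.isIntertwining]
  change σ (x * h) (σ (h⁻¹ : H) _) = _
  rw [← Module.End.mul_apply, ← map_mul]
  simp

theorem cosetTerm_out (x : G) : cosetTerm σ θ (x : G ⧸ H).out = cosetTerm σ θ x := by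
  obtain ⟨h, hh⟩ := QuotientGroup.mk_out_eq_mul H x
  rw [hh, cosetTerm_mul]

theorem finite_support_cosetTerm (ho : IsOpen (H : Set G)) (s : Reg k G) :
    (Function.support fun q : G ⧸ H => cosetTerm σ θ q.out s).Finite := by
  have hfin : (cosetLC ho '' tsupport s.1).Finite := by
    let _ : TopologicalSpace (G ⧸ H) := ⊥
    have : DiscreteTopology (G ⧸ H) := ⟨rfl⟩
    exact (IsCompact.image s.2.2 (cosetLC ho).isLocallyConstant.continuous).finite_of_discrete
  refine hfin.subset fun q hq => ?_
  by_contra hn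
  refine hq ?_
  have : resReg k H (regLeft k G q.out⁻¹ s) = 0 := by
    refine Subtype.ext (funext fun h => ?_)
    change s.1 (q.out⁻¹⁻¹ * h) = 0
    rw [inv_inv]
    refine image_eq_zero_of_notMem_tsupport fun hmem => hn ⟨_, hmem, ?_⟩
    change ((q.out * h : G) : G ⧸ H) = q
    rw [QuotientGroup.mk_mul_of_mem _ h.2, QuotientGroup.out_eq']
  change σ q.out (θ (resReg k H (regLeft k G q.out⁻¹ s))) = 0
  rw [this, map_zero, map_zero]

/-- The `G`-equivariant extension to `k(G)` of an `H`-equivariant map on `k(H)`. -/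
def equivariantExt (ho : IsOpen (H : Set G)) : (regLeft k G).IntertwiningMap σ where
  toFun s := ∑ᶠ q : G ⧸ H, cosetTerm σ θ q.out s
  map_add' s t := by
    rw [← finsum_add_distrib (finite_support_cosetTerm σ θ ho s)
      (finite_support_cosetTerm σ θ ho t)]
    exact finsum_congr fun q => map_add _ s t
  map_smul' c s := by
    rw [RingHom.id_apply]
    refine Eq.trans (finsum_congr fun q => map_smul _ c s)
      (map_finsum (DistribSMul.toAddMonoidHom Z c) (finite_support_cosetTerm σ θ ho s)).symm
  isIntertwining' g := LinearMap.ext fun s => by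
    refine Eq.trans ?_ (map_finsum (σ g) (finite_support_cosetTerm σ θ ho s)).symm
    -- Translation by `g` permutes the cosets, and `g * q.out` may serve as the representative of `g
    -- q`.
    refine (finsum_comp_equiv (MulAction.toPerm (α := G) (β := G ⧸ H) g)).symm.trans
      (finsum_congr fun q => ?_)
    have hq : MulAction.toPerm g q = ((g * q.out : G) : G ⧸ H) := by
      conv_lhs => rw [← QuotientGroup.out_eq' q]
      rfl
    rw [hq, cosetTerm_out]
    change σ (g * q.out) (θ (resReg k H (regLeft k G (g * q.out)⁻¹ (regLeft k G g s)))) =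
      σ g (σ q.out (θ (resReg k H (regLeft k G q.out⁻¹ s))))
    rw [map_mul, Module.End.mul_apply, mul_inv_rev, map_mul, Module.End.mul_apply,
      ← Module.End.mul_apply (regLeft k G g⁻¹), ← map_mul, inv_mul_cancel, map_one,
      Module.End.one_apply]

theorem equivariantExt_extReg (ho : IsOpen (H : Set G)) (s : Reg k H) :
    equivariantExt σ θ ho (extReg ho s) = θ s := by
  change ∑ᶠ q : G ⧸ H, cosetTerm σ θ q.out (extReg ho s) = θ s
  rw [finsum_eq_single _ ((1 : G) : G ⧸ H), cosetTerm_out]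
  · change σ 1 (θ (resReg k H (regLeft k G 1⁻¹ (extReg ho s)))) = θ s
    rw [inv_one, map_one, map_one, Module.End.one_apply, Module.End.one_apply]
    exact congrArg θ (Subtype.ext (funext fun x => extReg_of_mem ho s x))
  · intro q hq
    have : resReg k H (regLeft k G q.out⁻¹ (extReg ho s)) = 0 := by
      refine Subtype.ext (funext fun h => ?_)
      refine extReg_of_notMem ho s (q.out⁻¹⁻¹ * h) fun hmem => hq ?_
      rw [inv_inv, H.mul_mem_cancel_right h.2] at hmem
      rw [← QuotientGroup.out_eq' q]
      exact QuotientGroup.eq.2 (by simpa using hmem)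
    change σ q.out (θ (resReg k H (regLeft k G q.out⁻¹ (extReg ho s)))) = 0
    rw [this, map_zero, map_zero]

/-- The space `k(G)` is spanned by the left translates of functions on `H`. -/
theorem Reg.mem_of_regLeft_mem (ho : IsOpen (H : Set G)) (S : Submodule k (Reg k G))
    (hS : ∀ (x : G) (s : Reg k H), regLeft k G x (extReg ho s) ∈ S) (s : Reg k G) : s ∈ S := by
  classical
  -- With extension by zero as `θ`, the term at `q` is `s` cut off to the coset `q`, so the terms
  -- sum to `s`.
  let θ : (regLeft k H).IntertwiningMap ((regLeft k G).comp H.subtype) :=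
    ⟨extReg ho, fun h => LinearMap.ext fun s => extReg_regLeft ho h s⟩
  have hs : s = ∑ᶠ q : G ⧸ H, cosetTerm (regLeft k G) θ q.out s := by
    refine Subtype.ext (funext fun y => ?_)
    let l : Reg k G →ₗ[k] k := LinearMap.proj y ∘ₗ (Reg k G).subtype
    change l s = l _
    rw [map_finsum l (finite_support_cosetTerm _ θ ho s),
      finsum_eq_single _ (y : G ⧸ H), cosetTerm_out]
    · change s.1 y = (extReg ho (resReg k H (regLeft k G y⁻¹ s))).1 (y⁻¹ * y)
      rw [inv_mul_cancel]
      refine Eq.trans ?_ (extReg_of_mem ho _ 1).symm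
      change s.1 y = s.1 (y⁻¹⁻¹ * (1 : G))
      rw [inv_inv, mul_one]
    · intro q hq
      refine extReg_of_notMem ho _ (q.out⁻¹ * y) fun hmem => hq ?_
      rw [← QuotientGroup.out_eq' q]
      exact QuotientGroup.eq.2 hmem
  rw [hs]
  exact finsum_induction (· ∈ S) (zero_mem _) (fun _ _ => add_mem) fun q => hS _ _

variable {σ} in
theorem equivariant_ext (ho : IsOpen (H : Set G)) {f f' : (regLeft k G).IntertwiningMap σ}
    (h : ∀ s, f (extReg ho s) = f' (extReg ho s)) : f = f' := by
  refine Representation.IntertwiningMap.ext (LinearMap.ext fun s => ?_)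
  refine Reg.mem_of_regLeft_mem ho (LinearMap.eqLocus f.toLinearMap f'.toLinearMap)
    (fun x s => ?_) s
  change f _ = f' _
  rw [f.isIntertwining, f'.isIntertwining, h]

end Extension

/-! ### The right action of the group by point measures. -/

section PointAction

variable {k : Type u} [Field k] {G : Type v} [Group G] [TopologicalSpace G] [IsTopologicalGroup G]

namespace Contramodule

variable (P : Contramodule.{w} k G)

/-- The action of the point measures on a contramodule; it is a right action of the group. -/
def act (g : G) : P.V →ₗ[k] P.V := P.π ∘ₗ Meas.dirac g

/-- Contraassociativity for the product of `μ` with the point measure at `g` in the second factor.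
-/
theorem act_pi (g : G) (μ : Meas k P.V G) :
    P.act g (P.π μ) = P.π (Meas.map ⟨fun x => x * g, continuous_mul_const g⟩ μ) := by
  classical
  let i : C(G, G × G) := ⟨fun x => (x, g), by fun_prop⟩
  refine Eq.trans (congrArg P.π ?_) (P.contraassoc (Meas.map i μ))
  have h : Meas.curry (Meas.map i μ) = Meas.dirac g μ := by
    refine Subtype.ext (funext fun U' => Subtype.ext (funext fun U => ?_))
    by_cases hg : g ∈ U'
    · refine Eq.trans (congrArg μ.1 (Clopens.ext (Set.ext fun x => and_iff_left hg)))
        (congrArg (fun ν : Meas k P.V G => ν.1 U) (if_pos hg)).symm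
    · refine Eq.trans ?_ (congrArg (fun ν : Meas k P.V G => ν.1 U) (if_neg hg)).symm
      refine (congrArg μ.1 (?_ : _ = ⊥)).trans (Meas.apply_bot μ)
      exact Clopens.ext (Set.eq_empty_of_forall_notMem fun x hx => hg hx.2)
  rw [h, Meas.mapValue_dirac]

/-- The mirror case, with the point measure in the first factor: there `g` acts on the values of the
measure. -/
theorem pi_map_mul {X : Type*} [TopologicalSpace X] (f : C(X, G)) (g : G) (μ : Meas k P.V X) :
    P.π (Meas.map ⟨fun x => g * f x, f.continuous.const_mul g⟩ μ) =
      P.π (Meas.map f (Meas.mapValue (P.act g) μ)) := by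
  classical
  let i : C(X, G × G) := ⟨fun x => (g, f x), by fun_prop⟩
  refine (P.contraassoc (Meas.map i μ)).symm.trans (congrArg P.π ?_)
  refine Subtype.ext (funext fun U' => congrArg P.π (Subtype.ext (funext fun U => ?_)))
  by_cases hg : g ∈ U
  · have h : Meas.preimage i (U ×ˢ U') = Meas.preimage f U' :=
      Clopens.ext (Set.ext fun x => and_iff_right hg)
    exact (congrArg μ.1 h).trans (if_pos hg).symm
  · refine Eq.trans ?_ (if_neg hg).symm
    refine (congrArg μ.1 (?_ : _ = ⊥)).trans (Meas.apply_bot μ)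
    exact Clopens.ext (Set.eq_empty_of_forall_notMem fun x hx => hg hx.1)

theorem act_one : P.act 1 = LinearMap.id := LinearMap.ext P.contraunit

theorem act_mul (g h : G) : P.act (g * h) = P.act h ∘ₗ P.act g := by
  refine LinearMap.ext fun p => ((P.act_pi h (Meas.dirac g p)).trans ?_).symm
  rfl

/-- The left action of the group on the linear maps out of a contramodule. -/
def dualRep (A : Type*) [AddCommGroup A] [Module k A] : Representation k G (P.V →ₗ[k] A) where
  toFun g := LinearMap.lcomp k A (P.act g)
  map_one' := LinearMap.ext fun φ => LinearMap.ext fun p =>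
    congrArg φ (LinearMap.congr_fun P.act_one p)
  map_mul' g h := LinearMap.ext fun φ => LinearMap.ext fun p =>
    congrArg φ (LinearMap.congr_fun (P.act_mul g h) p)

end Contramodule

theorem Contratensor.mk_act {N : Type*} [AddCommGroup N] [Module k N] (ρ : Representation k G N)
    (hρ : IsSmooth ρ) (P : Contramodule.{w} k G) (g : G) (x : N) (p : P.V) :
    mk ρ hρ P (x ⊗ₜ[k] P.act g p) = mk ρ hρ P (ρ g x ⊗ₜ[k] p) := by
  refine (mk_pi ρ hρ P x (Meas.dirac g p)).trans ?_
  rw [Meas.integral_dirac]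
  rfl

end PointAction

/-! ### Inversion on `k(G)`, transferring results on left translations to right ones. -/

section Inversion

variable (k : Type u) [Field k] (G : Type v) [Group G] [TopologicalSpace G] [IsTopologicalGroup G]

/-- The inversion `s(x) ↦ s(x⁻¹)`, exchanging the left and the right translations. -/
def invReg : Reg k G →ₗ[k] Reg k G where
  toFun s := ⟨fun x => s.1 x⁻¹, s.2.1.comp_continuous continuous_inv,
    s.2.2.comp_homeomorph (Homeomorph.inv G)⟩
  map_add' _ _ := rfl
  map_smul' _ _ := rfl

variable {k G}

theorem invReg_invReg (s : Reg k G) : invReg k G (invReg k G s) = s :=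
  Subtype.ext (funext fun x => congrArg s.1 (inv_inv x))

theorem invReg_regRight (g : G) (s : Reg k G) :
    invReg k G (regRight k G g s) = regLeft k G g (invReg k G s) :=
  Subtype.ext (funext fun x => congrArg s.1 (by simp))

theorem invReg_regLeft (g : G) (s : Reg k G) :
    invReg k G (regLeft k G g s) = regRight k G g (invReg k G s) :=
  Subtype.ext (funext fun x => congrArg s.1 (by simp))

theorem invReg_extReg {H : Subgroup G} [CompactSpace H] (ho : IsOpen (H : Set G)) (s : Reg k H) :
    invReg k G (extReg ho s) = extReg ho (invReg k H s) := by
  refine Subtype.ext (funext fun x => ?_)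
  change (extReg ho s).1 x⁻¹ = _
  by_cases hx : x ∈ H
  · exact (extReg_of_mem ho s (⟨x, hx⟩ : H)⁻¹).trans
      (extReg_of_mem ho (invReg k H s) ⟨x, hx⟩).symm
  · rw [extReg_of_notMem ho _ x hx, extReg_of_notMem ho]
    rwa [H.inv_mem_iff]

/-- The space `k(G)` is spanned by the right translates of functions on `H`. -/
theorem Reg.mem_of_regRight_mem {H : Subgroup G} [CompactSpace H] (ho : IsOpen (H : Set G))
    (S : Submodule k (Reg k G)) (hS : ∀ (x : G) (s : Reg k H), regRight k G x (extReg ho s) ∈ S)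
    (s : Reg k G) : s ∈ S := by
  have h := Reg.mem_of_regLeft_mem ho (S.comap (invReg k G)) (fun x s => ?_) (invReg k G s)
  · rwa [Submodule.mem_comap, invReg_invReg] at h
  · rw [Submodule.mem_comap, invReg_regLeft, invReg_extReg]
    exact hS _ _

end Inversion

/-! ### The functors and restriction -/

section Restriction

variable {k : Type u} [Field k] {G : Type v} [Group G] [TopologicalSpace G] [IsTopologicalGroup G]
  {H : Subgroup G}

variable (H) in
/-- The map `s ↦ (p ↦ s ⊙ p)` on `k(H)`. -/
def contratensorCurry (P : Contramodule.{w} k G) : Reg k H →ₗ[k] P.V →ₗ[k]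
    Contratensor (regRight k H) isSmooth_regRight ((Contramodule.res H).obj P) :=
  TensorProduct.curry (Contratensor.mk (regRight k H) isSmooth_regRight
    ((Contramodule.res H).obj P))

theorem contratensorCurry_regRight (P : Contramodule.{w} k G) (h : H) (s : Reg k H) (p : P.V) :
    contratensorCurry H P (regRight k H h s) p = contratensorCurry H P s (P.act h p) :=
  (Contratensor.mk_act (regRight k H) isSmooth_regRight ((Contramodule.res H).obj P) h s p).symm

variable [CompactSpace H]

/-- The restriction of `Ψ_G(M)` to a compact open subgroup `H` is `Ψ_H` of the restriction. -/
def resPsi (ho : IsOpen (H : Set G)) (M : SmoothModule.{max w u v} k G) :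
    (Contramodule.res H).obj ((Psi.{w} k G).obj M) ⟶
      (Psi.{w} k H).obj ((SmoothModule.res H).obj M) :=
  Contramodule.Hom.mk (P := (Contramodule.res H).obj (homContra k G M.obj.ρ))
    (Q := homContra k H (M.obj.ρ.comp H.subtype))
    { toFun := fun (f : (regLeft k G).IntertwiningMap M.obj.ρ) =>
        ⟨f.toLinearMap ∘ₗ extReg ho, fun h => LinearMap.ext fun s => by
          change f (extReg ho (regLeft k H h s)) = M.obj.ρ h (f (extReg ho s))
          rw [extReg_regLeft, f.isIntertwining]⟩
      map_add' := fun _ _ => rfl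
      map_smul' := fun _ _ => rfl }
    (fun μ => Representation.IntertwiningMap.ext (LinearMap.ext fun s => by
      let F : LocallyConstant H ((regLeft k G).IntertwiningMap M.obj.ρ →ₗ[k] M.obj.V) :=
        (evalOrbit M.obj.ρ (extReg ho s)).comap ⟨H.subtype, continuous_subtype_val⟩
      refine (Meas.integral_map _ (evalOrbit M.obj.ρ (extReg ho s)) F (fun _ => rfl) μ).trans ?_
      refine (Meas.integral_mapValue _ (evalOrbit (M.obj.ρ.comp H.subtype) s) F
        (fun h => LinearMap.ext fun f => ?_) μ).symm
      exact congrArg f (extReg_regRight ho h s).symm))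

/-- Frobenius reciprocity: an `H`-map on `k(H)` extends to `k(G)` by `equivariantExt`, uniquely
because left translates of functions on `H` span. -/
theorem bijective_resPsi (ho : IsOpen (H : Set G)) (M : SmoothModule.{max w u v} k G) :
    Function.Bijective (resPsi.{w} ho M).lin := by
  constructor
  · intro f f' h
    exact equivariant_ext ho fun s => congrArg
      (fun φ : (regLeft k H).IntertwiningMap (M.obj.ρ.comp H.subtype) => φ s) h
  · intro θ
    refine ⟨equivariantExt M.obj.ρ θ ho, ?_⟩
    exact Representation.IntertwiningMap.ext (LinearMap.ext fun s =>
      equivariantExt_extReg M.obj.ρ θ ho s)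

/-- The map `k(H) ⊙_{k,H} P → k(G) ⊙_{k,G} P` given by extension by zero. -/
def contratensorExt (ho : IsOpen (H : Set G)) (P : Contramodule.{w} k G) :
    Contratensor (regRight k H) isSmooth_regRight ((Contramodule.res H).obj P) →ₗ[k]
      Contratensor (regRight k G) isSmooth_regRight P :=
  Contratensor.lift (Contratensor.mk (regRight k G) isSmooth_regRight P ∘ₗ
    TensorProduct.map (extReg ho) LinearMap.id) (fun s μ => by
      let E := (orbit (regRight k G) isSmooth_regRight (extReg ho s)).map fun t =>
        Contratensor.mk (regRight k G) isSmooth_regRight P ∘ₗ TensorProduct.mk k (Reg k G) P.V t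
      refine (Contratensor.mk_pi' (regRight k G) isSmooth_regRight P (extReg ho s) _ E
        (fun _ _ => rfl)).trans ?_
      refine Meas.integral_map _ E _ (fun h => LinearMap.ext fun p => ?_) μ
      change Contratensor.mk _ _ P (extReg ho (regRight k H h s) ⊗ₜ[k] p) = _
      rw [extReg_regRight]
      rfl)

/-- Functions in `k(G)` are sums of right translates of functions on `H`, and a translation moves
across `⊙` to the point action on `P`. -/
theorem surjective_contratensorExt (ho : IsOpen (H : Set G)) (P : Contramodule.{w} k G) :
    Function.Surjective (contratensorExt ho P) := by
  refine LinearMap.range_eq_top.1 (top_le_iff.1 ?_)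
  rintro x -
  obtain ⟨t, rfl⟩ := Contratensor.mk_surjective _ _ _ x
  induction t with
  | zero => rw [map_zero]; exact zero_mem _
  | add a b ha hb => rw [map_add]; exact add_mem ha hb
  | tmul s p =>
    refine Reg.mem_of_regRight_mem ho ((LinearMap.range (contratensorExt ho P)).comap
      (Contratensor.mk _ _ P ∘ₗ (TensorProduct.mk k (Reg k G) P.V).flip p)) (fun x s => ?_) s
    change Contratensor.mk _ _ P (regRight k G x (extReg ho s) ⊗ₜ[k] p) ∈
      LinearMap.range (contratensorExt ho P)
    rw [← Contratensor.mk_act]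
    exact ⟨Contratensor.mk _ _ ((Contramodule.res H).obj P) (s ⊗ₜ[k] P.act x p), rfl⟩

variable (H) in
/-- The map `contratensorCurry`, as a homomorphism with respect to the left translations. -/
def contratensorHom (P : Contramodule.{w} k G) : (regLeft k H).IntertwiningMap
    ((P.dualRep (Contratensor (regRight k H) isSmooth_regRight
      ((Contramodule.res H).obj P))).comp H.subtype) where
  toLinearMap := contratensorCurry H P ∘ₗ invReg k H
  isIntertwining' h := LinearMap.ext fun s => LinearMap.ext fun p => by
    change contratensorCurry H P (invReg k H (regLeft k H h s)) p =
      contratensorCurry H P (invReg k H s) (P.act h p)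
    rw [invReg_regLeft, contratensorCurry_regRight]

/-- The equivariant extension of `s ↦ (p ↦ s ⊙ p)` from `k(H)` to `k(G)`. -/
def contratensorRes (ho : IsOpen (H : Set G)) (P : Contramodule.{w} k G) :
    Reg k G →ₗ[k] P.V →ₗ[k]
      Contratensor (regRight k H) isSmooth_regRight ((Contramodule.res H).obj P) :=
  (equivariantExt _ (contratensorHom H P) ho).toLinearMap ∘ₗ invReg k G

theorem contratensorRes_extReg (ho : IsOpen (H : Set G)) (P : Contramodule.{w} k G) (s : Reg k H)
    (p : P.V) : contratensorRes ho P (extReg ho s) p =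
      Contratensor.mk _ _ ((Contramodule.res H).obj P) (s ⊗ₜ[k] p) := by
  change equivariantExt _ (contratensorHom H P) ho (invReg k G (extReg ho s)) p = _
  rw [invReg_extReg, equivariantExt_extReg]
  change contratensorCurry H P (invReg k H (invReg k H s)) p = _
  rw [invReg_invReg]
  rfl

theorem contratensorRes_regRight (ho : IsOpen (H : Set G)) (P : Contramodule.{w} k G) (g : G)
    (s : Reg k G) (p : P.V) :
    contratensorRes ho P (regRight k G g s) p = contratensorRes ho P s (P.act g p) := by
  change equivariantExt _ (contratensorHom H P) ho (invReg k G (regRight k G g s)) p = _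
  rw [invReg_regRight, Representation.IntertwiningMap.isIntertwining]
  rfl

/-- The map `contratensorRes` respects the relations defining the contratensor product. -/
theorem contratensorRes_pi (ho : IsOpen (H : Set G)) (P : Contramodule.{w} k G) (s : Reg k G)
    (μ : Meas k P.V G) : contratensorRes ho P s (P.π μ) = Meas.integral
      ((orbit (regRight k G) isSmooth_regRight s).map (contratensorRes ho P)) μ := by
  let R := contratensorRes ho P
  let E (s : Reg k G) := (orbit (regRight k G) isSmooth_regRight s).map R
  have base : ∀ (s : Reg k H) (μ : Meas k P.V G),
      R (extReg ho s) (P.π μ) = Meas.integral (E (extReg ho s)) μ := by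
    intro s μ
    -- Both sides are linear in `μ`, so it suffices to treat measures carried by one coset `d H`.
    refine Meas.mem_of_cosetMap_mem ho (LinearMap.eqLocus (R (extReg ho s) ∘ₗ P.π)
      (Meas.integralₗ (E (extReg ho s)))) (fun d μ => ?_) μ
    change R (extReg ho s) (P.π _) = Meas.integral (E (extReg ho s)) (Meas.map (cosetMap H d) μ)
    let F := (E (extReg ho s)).comap (cosetMap H d)
    rw [Meas.integral_map _ _ F (fun _ => rfl)]
    -- The translation by `d` is absorbed into the values, leaving a contraaction of `H`, for which
    -- the relation holds in the contratensor product over `H`.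
    refine (congrArg _ (P.pi_map_mul ⟨H.subtype, continuous_subtype_val⟩ d μ)).trans ?_
    rw [contratensorRes_extReg]
    let F₁ := (orbit (regRight k H) isSmooth_regRight s).map (contratensorCurry H P)
    refine (Contratensor.mk_pi' _ _ ((Contramodule.res H).obj P) s (Meas.mapValue (P.act d) μ) F₁
      (fun _ _ => rfl)).trans ?_
    refine Meas.integral_mapValue _ F₁ F (fun h => LinearMap.ext fun p => ?_) μ
    change R (regRight k G (d * h) (extReg ho s)) p =
      Contratensor.mk _ _ ((Contramodule.res H).obj P) (regRight k H h s ⊗ₜ[k] P.act d p)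
    rw [map_mul, Module.End.mul_apply, contratensorRes_regRight, ← extReg_regRight,
      contratensorRes_extReg]
  let S : Submodule k (Reg k G) :=
    { carrier := {s | ∀ μ, R s (P.π μ) = Meas.integral (E s) μ}
      add_mem' := fun {a b} ha hb μ => by
        rw [Meas.integral_add_left (E a) (E b) (E (a + b)) (fun g => by
          change R (regRight k G g (a + b)) = _
          rw [map_add, map_add]
          rfl), ← ha, ← hb, map_add]
        rfl
      zero_mem' := fun μ => by
        rw [map_zero]
        -- The integrand vanishes, hence equals zero times itself, and so does its integral.
        have h := Meas.map_integral (LinearMap.lsmul k _ (0 : k)) (E 0) (E 0) (fun g => by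
          change R (regRight k G g 0) = _ ∘ₗ R (regRight k G g 0)
          rw [map_zero, map_zero, LinearMap.comp_zero]) μ
        exact (zero_smul k _).symm.trans h
      smul_mem' := fun c a ha μ => by
        rw [← Meas.map_integral (LinearMap.lsmul k _ c) (E a) (E (c • a)) (fun g => by
          change R (regRight k G g (c • a)) = _
          rw [map_smul, map_smul]
          rfl), ← ha, map_smul]
        rfl }
  refine Reg.mem_of_regRight_mem ho S (fun c s μ => ?_) s μ
  -- A right translation of the function by `c` is traded for the pushforward of `μ` along `x ↦ x *
  -- c`.
  rw [contratensorRes_regRight, P.act_pi, base]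
  refine Meas.integral_map _ _ _ (fun g => ?_) μ
  change R (regRight k G g (regRight k G c (extReg ho s))) = R (regRight k G (g * c) (extReg ho s))
  rw [map_mul, Module.End.mul_apply]

/-- By `contratensorRes_pi` the map `contratensorRes` descends to the contratensor product over `G`,
where it is a left inverse. -/
theorem bijective_contratensorExt (ho : IsOpen (H : Set G)) (P : Contramodule.{w} k G) :
    Function.Bijective (contratensorExt ho P) := by
  refine ⟨?_, surjective_contratensorExt ho P⟩
  let r : Contratensor (regRight k G) isSmooth_regRight P →ₗ[k] _ :=
    Contratensor.lift (TensorProduct.lift (contratensorRes ho P)) (fun s μ =>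
      (contratensorRes_pi ho P s μ).trans rfl)
  have h : r ∘ₗ contratensorExt ho P = LinearMap.id :=
    Contratensor.lin_ext fun s p => contratensorRes_extReg ho P s p
  exact Function.LeftInverse.injective (LinearMap.congr_fun h)

/-- The restriction of `Φ_G(P)` to a compact open subgroup `H` is `Φ_H` of the restriction. -/
def phiRes (ho : IsOpen (H : Set G)) (P : Contramodule.{max w u v} k G) :
    (Phi.{w} k H).obj ((Contramodule.res H).obj P) ⟶
      (SmoothModule.res H).obj ((Phi.{w} k G).obj P) :=
  ObjectProperty.homMk (Rep.ofHom
    { toLinearMap := contratensorExt ho P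
      isIntertwining' := fun h => Contratensor.lin_ext fun s p => by
        change Contratensor.mk _ _ P (extReg ho (regLeft k H h s) ⊗ₜ[k] p) = _
        rw [extReg_regLeft]
        rfl })

instance isIso_resPsi (ho : IsOpen (H : Set G)) (M : SmoothModule.{max w u v} k G) :
    IsIso (resPsi.{w} ho M) :=
  Contramodule.isIso_of_bijective _ (bijective_resPsi ho M)

instance isIso_phiRes (ho : IsOpen (H : Set G)) (P : Contramodule.{max w u v} k G) :
    IsIso (phiRes.{w} ho P) :=
  SmoothModule.isIso_of_bijective _ (bijective_contratensorExt ho P)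

/-- Both composites send `s ⊙ f` to the value of `f` on the extension of `s` by zero. -/
theorem phiRes_counit (ho : IsOpen (H : Set G)) (M : SmoothModule.{max w u v} k G) :
    phiRes.{w} ho ((Psi.{w} k G).obj M) ≫
        (SmoothModule.res H).map ((adjunction.{w} k G).counit.app M) =
      (Phi.{w} k H).map (resPsi.{w} ho M) ≫
        (adjunction.{w} k H).counit.app ((SmoothModule.res H).obj M) :=
  ObjectProperty.hom_ext _ (Rep.hom_ext (Representation.IntertwiningMap.ext
    (Contratensor.lin_ext fun _ _ => rfl)))

theorem unit_resPsi (ho : IsOpen (H : Set G)) (P : Contramodule.{max w u v} k G) :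
    (Contramodule.res H).map ((adjunction.{w} k G).unit.app P) ≫
        resPsi.{w} ho ((Phi.{w} k G).obj P) =
      (adjunction.{w} k H).unit.app ((Contramodule.res H).obj P) ≫
        (Psi.{w} k H).map (phiRes.{w} ho P) := rfl

end Restriction

/-! ### The equivalence -/

section Equivalence

variable {k : Type u} [Field k] {G : Type v} [Group G] [TopologicalSpace G]

theorem SmoothModule.isIso_of_res (H : Subgroup G) {M N : SmoothModule.{w} k G} (f : M ⟶ N)
    [IsIso ((SmoothModule.res H).map f)] : IsIso f :=
  SmoothModule.isIso_of_bijective f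
    (SmoothModule.bijective_of_isIso ((SmoothModule.res H).map f))

variable [IsTopologicalGroup G]

theorem Contramodule.isIso_of_res (H : Subgroup G) {P Q : Contramodule.{w} k G} (f : P ⟶ Q)
    [IsIso ((Contramodule.res H).map f)] : IsIso f :=
  Contramodule.isIso_of_bijective f
    (Contramodule.bijective_of_isIso ((Contramodule.res H).map f))

theorem weaklyCompactlyProjective_psi (M : SmoothModule.{max w u v} k G)
    (hM : WeaklyCompactlyInjective k G M) :
    WeaklyCompactlyProjective k G ((Psi.{w} k G).obj M) := by
  obtain ⟨H, ho, hc, _⟩ := hM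
  have := isCompact_iff_compactSpace.1 hc
  exact ⟨H, ho, hc, Projective.of_iso (asIso (resPsi.{w} ho M)).symm (projective_psi.{w} _)⟩

theorem weaklyCompactlyInjective_phi (P : Contramodule.{max w u v} k G)
    (hP : WeaklyCompactlyProjective k G P) :
    WeaklyCompactlyInjective k G ((Phi.{w} k G).obj P) := by
  obtain ⟨H, ho, hc, _⟩ := hP
  have := isCompact_iff_compactSpace.1 hc
  exact ⟨H, ho, hc, Injective.of_iso (asIso (phiRes.{w} ho P)) (injective_phi.{w} _)⟩

theorem isIso_counit_of_weaklyCompactlyInjective (M : SmoothModule.{max w u v} k G)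
    (hM : WeaklyCompactlyInjective k G M) : IsIso ((adjunction.{w} k G).counit.app M) := by
  obtain ⟨H, ho, hc, _⟩ := hM
  have := isCompact_iff_compactSpace.1 hc
  have := isIso_counit_of_injective.{w} ((SmoothModule.res H).obj M)
  have h : IsIso ((Phi.{w} k H).map (resPsi.{w} ho M) ≫
      (adjunction.{w} k H).counit.app ((SmoothModule.res H).obj M)) := inferInstance
  have : IsIso ((SmoothModule.res H).map ((adjunction.{w} k G).counit.app M)) :=
    IsIso.of_isIso_fac_left (hh := h) (phiRes_counit.{w} ho M)
  exact SmoothModule.isIso_of_res H _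

theorem isIso_unit_of_weaklyCompactlyProjective (P : Contramodule.{max w u v} k G)
    (hP : WeaklyCompactlyProjective k G P) : IsIso ((adjunction.{w} k G).unit.app P) := by
  obtain ⟨H, ho, hc, _⟩ := hP
  have := isCompact_iff_compactSpace.1 hc
  have := isIso_unit_of_projective.{w} ((Contramodule.res H).obj P)
  have h : IsIso ((adjunction.{w} k H).unit.app ((Contramodule.res H).obj P) ≫
      (Psi.{w} k H).map (phiRes.{w} ho P)) := inferInstance
  have : IsIso ((Contramodule.res H).map ((adjunction.{w} k G).unit.app P)) :=
    IsIso.of_isIso_fac_right (hh := h) (unit_resPsi.{w} ho P)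
  exact Contramodule.isIso_of_res H _

end Equivalence

end SemicoSemicontra

end

open CategoryTheory SemicoSemicontra in
theorem mainTheorem8 (k : Type u) [Field k] (G : Type v) [Group G] [TopologicalSpace G]
    [IsTopologicalGroup G] [LocallyCompactSpace G] [TotallyDisconnectedSpace G] :
    ∃ (hΨ : ∀ M : SmoothModule.{max w u v} k G, WeaklyCompactlyInjective k G M →
        WeaklyCompactlyProjective k G ((Psi.{w} k G).obj M))
      (hΦ : ∀ P : Contramodule.{max w u v} k G, WeaklyCompactlyProjective k G P →
        WeaklyCompactlyInjective k G ((Phi.{w} k G).obj P))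
      (e : (WeaklyCompactlyInjective.{max w u v} k G).FullSubcategory ≌
        (WeaklyCompactlyProjective.{max w u v} k G).FullSubcategory),
      e.functor = (WeaklyCompactlyProjective k G).lift
          ((WeaklyCompactlyInjective k G).ι ⋙ Psi.{w} k G) (fun M => hΨ M.obj M.property) ∧
      e.inverse = (WeaklyCompactlyInjective k G).lift
          ((WeaklyCompactlyProjective k G).ι ⋙ Phi.{w} k G) (fun P => hΦ P.obj P.property) ∧
      (∀ M : SmoothModule.{max w u v} k G, WeaklyCompactlyInjective k G M →
        IsIso ((adjunction.{w} k G).counit.app M)) ∧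
      (∀ P : Contramodule.{max w u v} k G, WeaklyCompactlyProjective k G P →
        IsIso ((adjunction.{w} k G).unit.app P)) := by
  have hε := isIso_counit_of_weaklyCompactlyInjective.{w} (k := k) (G := G)
  have hη := isIso_unit_of_weaklyCompactlyProjective.{w} (k := k) (G := G)
  -- The adjunction has `Phi` as its left adjoint, so the equivalence is built in that direction and
  -- then reversed. The functors are kept as given, so both identifications are definitional.
  refine ⟨weaklyCompactlyProjective_psi.{w}, weaklyCompactlyInjective_phi.{w},
    (CategoryTheory.Equivalence.mk
      ((WeaklyCompactlyInjective k G).lift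
        ((WeaklyCompactlyProjective k G).ι ⋙ Phi.{w} k G)
        (fun P => weaklyCompactlyInjective_phi.{w} P.obj P.property))
      ((WeaklyCompactlyProjective k G).lift
        ((WeaklyCompactlyInjective k G).ι ⋙ Psi.{w} k G)
        (fun M => weaklyCompactlyProjective_psi.{w} M.obj M.property))
      (NatIso.ofComponents
        (fun P => (WeaklyCompactlyProjective k G).isoMk
          (@asIso _ _ _ _ ((adjunction.{w} k G).unit.app P.obj) (hη P.obj P.property)))
        (fun f => ObjectProperty.hom_ext _ ((adjunction.{w} k G).unit.naturality f.hom)))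
      (NatIso.ofComponents
        (fun M => (WeaklyCompactlyInjective k G).isoMk
          (@asIso _ _ _ _ ((adjunction.{w} k G).counit.app M.obj) (hε M.obj M.property)))
        (fun f => ObjectProperty.hom_ext _ ((adjunction.{w} k G).counit.naturality f.hom)))).symm,
    rfl, rfl, hε, hη⟩
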